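/- Notation: $\mathbf S^n$ is the space of real symmetric $n\times n$ matrices with inner product $\mathrm{Tr}(XY)$; $A\preceq B$ means that $B-A$ is symmetric positive semidefinite; $\mathbf S^n_+=\{S\in\mathbf S^n: S\succeq 0\}$; $\|\cdot\|$ is the spectral norm and $\|\cdot\|_F$ the Frobenius norm of a matrix; $A^{1/2}$ is the positive semidefinite square root of $A\succeq0$. Regular data: let $E,E'$ be finite-dimensional real Euclidean spaces. A triple $\mathcal F\subset E$, $\mathcal M\subset E'$, $\Phi:\mathcal F\times\mathcal M\to\mathbf R$ is called regular data if $\mathcal F$ is a closed convex set, symmetric with respect to the origin, with $0\in\mathrm{int}\,\mathcal F$; $\mathcal M$ is a closed convex set; and $\Phi$ is continuous on $\mathcal F\times\mathcal M$, convex in its first argument $h\in\mathcal F$ and concave in its second argument $\mu\in\mathcal M$. Proposition. Let $d$ be a positive integer, let $\mathcal V\subset\mathbf S^d_+$ be nonempty, convex and compact, let $\Theta_*\in\mathbf S^d$ be positive definite and $\delta\ge 0$, and suppose that for all $\Theta\in\mathcal V$ $$\Theta\preceq\Theta_*\quad\text{and}\quad \|\Theta^{1/2}\Theta_*^{-1/2}-I\|\le\delta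 .$$ Let $\gamma\in(0,1)$, $$\mathcal Z^+=\{Z\in\mathbf S^{d+1}_+: Z_{d+1,d+1}=1\},\qquad \mathcal H_\gamma=\{H\in\mathbf S^d: -\gamma\Theta_*^{-1}\preceq H\preceq\gamma\Theta_*^{-1}\},$$ $\mathcal F=\mathbf R^d\times\mathcal H_\gamma\subset\mathbf R^d\times\mathbf S^d$, $\mathcal M^+=\mathcal V\times\mathcal Z^+\subset\mathbf S^d\times\mathbf S^{d+1}$, and set $$\Phi(h,H;\Theta,Z)=\Upsilon(H,\Theta)+\Gamma(h,H;Z),$$ $$\Upsilon(H,\Theta)=-\tfrac12\ln\det(I-\Theta_*^{1/2}H\Theta_*^{1/2})+\tfrac12\mathrm{Tr}([\Theta-\Theta_*]H)+\frac{\delta(2+\delta)}{2(1-\|\Theta_*^{1/2}H\Theta_*^{1/2}\|)}\|\Theta_*^{1/2}H\Theta_*^{1/2}\|_F^2,$$ $$\Gamma(h,H;Z)=\tfrac12\mathrm{Tr}\left(Z\left[\begin{bmatrix}H&h\\ h^T&0\end{bmatrix}+[H,h]^T[\Theta_*^{-1}-H]^{-1}[H,h]\right]\right),$$ where $[H,h]$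 is the $d\times(d+1)$ matrix obtained by appending the column $h$ to $H$. Then: (i) $\mathcal F,\mathcal M^+,\Phi$ form regular data, and for all $(\theta,\Theta)\in\mathbf R^d\times\mathcal V$ and all $(h,H)\in\mathcal F$ the expectation below is finite and $$\ln\left(\mathbf E_{\zeta\sim\mathcal N(\theta,\Theta)}\left\{e^{h^T\zeta+\frac12\zeta^TH\zeta}\right\}\right)\le\Phi\left(h,H;\Theta,[\theta;1][\theta;1]^T\right),$$ where $[\theta;1]\in\mathbf R^{d+1}$ is $\theta$ with the entry $1$ appended. (ii) $\Phi$ is coercive in the convex argument: whenever $(\Theta,Z)\in\mathcal M^+$, $(h_i,H_i)\in\mathcal F$ for $i=1,2,\dots$ and $\|(h_i,H_i)\|\to\infty$ as $i\to\infty$ (norm $\sqrt{\|h\|_2^2+\|H\|_F^2}$), one has $\Phi(h_i,H_i;\Theta,Z)\to\infty$. -/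

import Mathlib

open MeasureTheory ProbabilityTheory Matrix
open scoped MatrixOrder

noncomputable section

/-- Regular data: a closed convex set `F`, symmetric with respect to the origin and with the origin
in its interior, a closed convex set `M`, and a function `Φ` that is continuous on `F × M`,
convex in its first argument and concave in its second one. -/
structure IsRegularData {E E' : Type*}
    [AddCommGroup E] [Module ℝ E] [TopologicalSpace E]
    [AddCommGroup E'] [Module ℝ E'] [TopologicalSpace E']
    (F : Set E) (M : Set E') (Φ : E → E' → ℝ) : Prop where
  isClosed_left : IsClosed F
  convex_left : Convex ℝ F
  symmetric_left : ∀ h ∈ F, -h ∈ F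
  zero_mem_interior : (0 : E) ∈ interior F
  isClosed_right : IsClosed M
  convex_right : Convex ℝ M
  continuousOn : ContinuousOn (fun p : E × E' => Φ p.1 p.2) (F ×ˢ M)
  convexOn : ∀ μ ∈ M, ConvexOn ℝ F (fun h => Φ h μ)
  concaveOn : ∀ h ∈ F, ConcaveOn ℝ M (fun μ => Φ h μ)

/-- The linear space of real symmetric matrices with rows and columns indexed by `n`. -/
def SymMat (n : Type*) : Submodule ℝ (Matrix n n ℝ) where
  carrier := {A | A.IsSymm}
  add_mem' := fun ha hb => ha.add hb
  zero_mem' := Matrix.isSymm_zero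
  smul_mem' := fun c _ ha => ha.smul c

/-- The spectral norm: the operator norm with respect to Euclidean norms. -/
def spectralNormMat {n : Type*} [Fintype n] [DecidableEq n] (A : Matrix n n ℝ) : ℝ :=
  ‖Matrix.toEuclideanCLM (𝕜 := ℝ) A‖

/-- The Frobenius norm. -/
def frobNorm {m n : Type*} [Fintype m] [Fintype n] (A : Matrix m n ℝ) : ℝ :=
  √(∑ i, ∑ j, A i j ^ 2)

/-- The Euclidean norm of a pair `(h, H)` of a vector and a symmetric matrix. -/
def pairNorm {d : ℕ} (p : EuclideanSpace ℝ (Fin d) × SymMat (Fin d)) : ℝ :=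
  √(‖p.1‖ ^ 2 + frobNorm (p.2 : Matrix (Fin d) (Fin d) ℝ) ^ 2)

/-- The set `H_γ = {H : -γ Θs⁻¹ ⪯ H ⪯ γ Θs⁻¹}` of symmetric matrices. -/
def HGamma {d : ℕ} (γ : ℝ) (Θs : Matrix (Fin d) (Fin d) ℝ) : Set (SymMat (Fin d)) :=
  {H | -(γ • Θs⁻¹) ≤ (H : Matrix (Fin d) (Fin d) ℝ) ∧
    (H : Matrix (Fin d) (Fin d) ℝ) ≤ γ • Θs⁻¹}

/-- The set of positive semidefinite matrices of size `d + 1` whose last diagonal entry is `1`.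
The index set is `Fin d ⊕ Unit`, with `Sum.inr ()` as the last index. -/
def ZPlus (d : ℕ) : Set (SymMat (Fin d ⊕ Unit)) :=
  {Z | (Z : Matrix (Fin d ⊕ Unit) (Fin d ⊕ Unit) ℝ).PosSemidef ∧
    (Z : Matrix (Fin d ⊕ Unit) (Fin d ⊕ Unit) ℝ) (Sum.inr ()) (Sum.inr ()) = 1}

/-- The matrix `[θ; 1] [θ; 1]ᵀ`. -/
def quadLift {d : ℕ} (θ : EuclideanSpace ℝ (Fin d)) : SymMat (Fin d ⊕ Unit) :=
  ⟨Matrix.vecMulVec (Sum.elim (fun i => θ i) (fun _ => 1))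
      (Sum.elim (fun i => θ i) (fun _ => 1)),
    Matrix.IsSymm.ext fun i j => by simp only [Matrix.vecMulVec_apply]; exact mul_comm _ _⟩

/-- The function `Υ(H, Θ)`. -/
def Upsilon {d : ℕ} (Θs : Matrix (Fin d) (Fin d) ℝ) (δ : ℝ) (H Θ : Matrix (Fin d) (Fin d) ℝ) : ℝ :=
  -(1 / 2) * Real.log (1 - CFC.sqrt Θs * H * CFC.sqrt Θs).det
    + (1 / 2) * ((Θ - Θs) * H).trace
    + δ * (2 + δ) / (2 * (1 - spectralNormMat (CFC.sqrt Θs * H * CFC.sqrt Θs)))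
      * frobNorm (CFC.sqrt Θs * H * CFC.sqrt Θs) ^ 2

/-- The `d × (d + 1)` matrix `[H, h]`. -/
def appendCol {d : ℕ} (h : EuclideanSpace ℝ (Fin d)) (H : Matrix (Fin d) (Fin d) ℝ) :
    Matrix (Fin d) (Fin d ⊕ Unit) ℝ :=
  Matrix.fromCols H (Matrix.replicateCol Unit (fun i => h i))

/-- The symmetric `(d + 1) × (d + 1)` matrix with blocks `H`, `h`, `hᵀ`, `0`. -/
def borderedMat {d : ℕ} (h : EuclideanSpace ℝ (Fin d)) (H : Matrix (Fin d) (Fin d) ℝ) :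
    Matrix (Fin d ⊕ Unit) (Fin d ⊕ Unit) ℝ :=
  Matrix.fromBlocks H (Matrix.replicateCol Unit (fun i => h i))
    (Matrix.replicateRow Unit (fun i => h i)) 0

/-- The function `Γ(h, H; Z)`. -/
def GammaFun {d : ℕ} (Θs : Matrix (Fin d) (Fin d) ℝ) (h : EuclideanSpace ℝ (Fin d))
    (H : Matrix (Fin d) (Fin d) ℝ) (Z : Matrix (Fin d ⊕ Unit) (Fin d ⊕ Unit) ℝ) : ℝ :=
  (1 / 2) * (Z * (borderedMat h H + (appendCol h H)ᵀ * (Θs⁻¹ - H)⁻¹ * appendCol h H)).trace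

/-- The function `Φ(h, H; Θ, Z) = Υ(H, Θ) + Γ(h, H; Z)`. -/
def PhiFun {d : ℕ} (Θs : Matrix (Fin d) (Fin d) ℝ) (δ : ℝ)
    (p : EuclideanSpace ℝ (Fin d) × SymMat (Fin d))
    (μ : SymMat (Fin d) × SymMat (Fin d ⊕ Unit)) : ℝ :=
  Upsilon Θs δ p.2 μ.1 + GammaFun Θs p.1 p.2 μ.2

end

/-! Write ζ = θ + Θ^{1/2}ξ with ξ standard Gaussian, and put v = Hθ + h, X = Θs^{1/2}HΘs^{1/2}, Y =
Θ^{1/2}HΘ^{1/2}. The log-moment is exactly hᵀθ + ½θᵀHθ − ½ log det(1 − Y) + ½ (Θ^{1/2}v)ᵀ(1 −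
Y)⁻¹(Θ^{1/2}v), by `integral_exp_quadratic_multivariateGaussian`. The determinant term is bounded by
Υ and the rest by Γ.

For Υ: Y = QXQᵀ with Q = Θ^{1/2}Θs^{-1/2}, a contraction within δ of the identity. The tangent
inequality for log det at 1 − Y leaves an error tr((1 − Y)⁻¹Y(Y − X)), which Frobenius estimates
control (`neg_log_det_one_sub_conj_le`).

For Γ: the formula xᵀA⁻¹x = max over y of 2xᵀy − yᵀAy does nearly all the work. Applied to the rows
of a factor B with Z = BᵀB, it gives joint convexity in (h, H), and it gives the lower bound
`le_GammaFun` with a free vector y. One choice of y yields the moment bound, another yields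
quadratic growth in h. Since H_γ is compact, a pair can only escape to infinity through h, so this
growth is coercivity. Concavity in (Θ, Z) is affinity. -/

/-! ### Spectral norm and quadratic forms. -/

section SpectralNorm

variable {n : Type*} [Fintype n]

lemma dotProduct_self_eq_norm_sq (x : n → ℝ) : x ⬝ᵥ x = ‖WithLp.toLp 2 x‖ ^ 2 := by
  rw [EuclideanSpace.real_norm_sq_eq, dotProduct]
  exact Finset.sum_congr rfl fun i _ => by simp [sq]

variable [DecidableEq n]

lemma spectralNormMat_nonneg (A : Matrix n n ℝ) : 0 ≤ spectralNormMat A := norm_nonneg _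

lemma norm_toLp_mulVec_le (A : Matrix n n ℝ) (x : n → ℝ) :
    ‖WithLp.toLp 2 (A *ᵥ x)‖ ≤ spectralNormMat A * ‖WithLp.toLp 2 x‖ :=
  (toEuclideanCLM (𝕜 := ℝ) A).le_opNorm (WithLp.toLp 2 x)

lemma mulVec_dotProduct_mulVec_le (A : Matrix n n ℝ) (x : n → ℝ) :
    (A *ᵥ x) ⬝ᵥ (A *ᵥ x) ≤ spectralNormMat A ^ 2 * (x ⬝ᵥ x) := by
  rw [dotProduct_self_eq_norm_sq, dotProduct_self_eq_norm_sq, ← mul_pow]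
  exact pow_le_pow_left₀ (norm_nonneg _) (norm_toLp_mulVec_le A x) 2

lemma abs_dotProduct_mulVec_le (A : Matrix n n ℝ) (x : n → ℝ) :
    |x ⬝ᵥ A *ᵥ x| ≤ spectralNormMat A * (x ⬝ᵥ x) := by
  have h := abs_real_inner_le_norm (WithLp.toLp 2 x)
    (toEuclideanCLM (𝕜 := ℝ) A (WithLp.toLp 2 x))
  rw [inner_toEuclideanCLM] at h
  refine h.trans ?_
  rw [dotProduct_self_eq_norm_sq, sq, mul_left_comm]
  exact mul_le_mul_of_nonneg_left (norm_toLp_mulVec_le A x) (norm_nonneg _)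

/-- The norm of a self-adjoint operator is the supremum of its absolute Rayleigh quotients. -/
lemma spectralNormMat_le_of_abs_dotProduct_mulVec_le {A : Matrix n n ℝ} (hA : A.IsSymm) {c : ℝ}
    (hc : 0 ≤ c) (h : ∀ x : n → ℝ, |x ⬝ᵥ A *ᵥ x| ≤ c * (x ⬝ᵥ x)) : spectralNormMat A ≤ c := by
  have hsym : (toEuclideanCLM (𝕜 := ℝ) A : EuclideanSpace ℝ n →ₗ[ℝ] EuclideanSpace ℝ n).IsSymmetric := by
    rw [coe_toEuclideanCLM_eq_toEuclideanLin]
    exact isSymmetric_toEuclideanLin_iff.2 (by rwa [isHermitian_iff_isSymm])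
  rw [spectralNormMat, ContinuousLinearMap.norm_eq_iSup_rayleighQuotient _ hsym]
  refine Real.iSup_le (fun x => ?_) hc
  rw [ContinuousLinearMap.rayleighQuotient, ContinuousLinearMap.reApplyInnerSelf_apply, abs_div,
    abs_of_nonneg (sq_nonneg ‖x‖)]
  refine div_le_of_le_mul₀ (sq_nonneg _) hc ?_
  have := h x.ofLp
  rw [dotProduct_self_eq_norm_sq] at this
  rw [real_inner_comm]
  simpa [inner_toEuclideanCLM] using this

lemma spectralNormMat_mul_le (A B : Matrix n n ℝ) :
    spectralNormMat (A * B) ≤ spectralNormMat A * spectralNormMat B := by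
  rw [spectralNormMat, map_mul]
  exact norm_mul_le _ _

lemma spectralNormMat_transpose (A : Matrix n n ℝ) :
    spectralNormMat Aᵀ = spectralNormMat A := by
  rw [← conjTranspose_eq_transpose_of_trivial, ← star_eq_conjTranspose, spectralNormMat, map_star,
    ContinuousLinearMap.star_eq_adjoint, LinearIsometryEquiv.norm_map]
  rfl

lemma spectralNormMat_le_one {A : Matrix n n ℝ}
    (h : ∀ x : n → ℝ, (A *ᵥ x) ⬝ᵥ (A *ᵥ x) ≤ x ⬝ᵥ x) : spectralNormMat A ≤ 1 := by
  refine ContinuousLinearMap.opNorm_le_bound _ zero_le_one fun x => ?_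
  have := h x.ofLp
  rw [dotProduct_self_eq_norm_sq, dotProduct_self_eq_norm_sq] at this
  rw [one_mul]
  exact (pow_le_pow_iff_left₀ (norm_nonneg _) (norm_nonneg _) two_ne_zero).1 this

lemma posDef_one_sub_of_spectralNormMat_lt_one {A : Matrix n n ℝ} (hA : A.IsSymm)
    (h : spectralNormMat A < 1) : (1 - A).PosDef := by
  refine PosDef.of_dotProduct_mulVec_pos ?_ fun x hx => ?_
  · rw [isHermitian_iff_isSymm]
    exact isSymm_one.sub hA
  · have h1 := (abs_le.1 (abs_dotProduct_mulVec_le A x)).2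
    have h2 : 0 < x ⬝ᵥ x := by
      simpa using dotProduct_star_self_pos_iff.2 hx
    simp only [star_trivial, sub_mulVec, one_mulVec, dotProduct_sub]
    nlinarith

end SpectralNorm

/-! ### Frobenius norm: Cauchy–Schwarz and mixed bounds with the spectral norm. -/

section FrobeniusNorm

variable {l m n : Type*} [Fintype l] [Fintype m] [Fintype n]

lemma frobNorm_nonneg (A : Matrix m n ℝ) : 0 ≤ frobNorm A := Real.sqrt_nonneg _

lemma frobNorm_sq (A : Matrix m n ℝ) : frobNorm A ^ 2 = ∑ i, ∑ j, A i j ^ 2 :=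
  Real.sq_sqrt (Finset.sum_nonneg fun _ _ => Finset.sum_nonneg fun _ _ => sq_nonneg _)

lemma frobNorm_eq_norm (A : Matrix m n ℝ) :
    frobNorm A = ‖WithLp.toLp 2 (fun p : m × n => A p.1 p.2)‖ := by
  rw [EuclideanSpace.norm_eq, frobNorm, Fintype.sum_prod_type]
  simp

lemma frobNorm_add_le (A B : Matrix m n ℝ) : frobNorm (A + B) ≤ frobNorm A + frobNorm B := by
  simp only [frobNorm_eq_norm]
  exact norm_add_le (WithLp.toLp 2 (fun p : m × n => A p.1 p.2))
    (WithLp.toLp 2 (fun p : m × n => B p.1 p.2))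

lemma frobNorm_smul (c : ℝ) (A : Matrix m n ℝ) : frobNorm (c • A) = |c| * frobNorm A := by
  simp only [frobNorm_eq_norm]
  exact norm_smul c (WithLp.toLp 2 (fun p : m × n => A p.1 p.2))

lemma frobNorm_transpose (A : Matrix m n ℝ) : frobNorm Aᵀ = frobNorm A := by
  rw [frobNorm, frobNorm, Finset.sum_comm]
  rfl

lemma trace_mul_le_frobNorm (A : Matrix m n ℝ) (B : Matrix n m ℝ) :
    (A * B).trace ≤ frobNorm A * frobNorm B := by
  have h := real_inner_le_norm (WithLp.toLp 2 (fun p : m × n => A p.1 p.2))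
    (WithLp.toLp 2 (fun p : m × n => Bᵀ p.1 p.2))
  rw [← frobNorm_eq_norm, ← frobNorm_eq_norm, frobNorm_transpose] at h
  refine le_of_eq_of_le ?_ h
  simp [trace, mul_apply, PiLp.inner_apply, Fintype.sum_prod_type, mul_comm]

lemma frobNorm_mul_le_spectralNormMat_left [DecidableEq m] (A : Matrix m m ℝ) (B : Matrix m n ℝ) :
    frobNorm (A * B) ≤ spectralNormMat A * frobNorm B := by
  refine (pow_le_pow_iff_left₀ (frobNorm_nonneg _)
    (mul_nonneg (spectralNormMat_nonneg _) (frobNorm_nonneg _)) two_ne_zero).1 ?_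
  rw [mul_pow, frobNorm_sq, frobNorm_sq, Finset.sum_comm, Finset.sum_comm (γ := m), Finset.mul_sum]
  refine Finset.sum_le_sum fun j _ => ?_
  have := mulVec_dotProduct_mulVec_le A (fun i => B i j)
  simpa [dotProduct, mulVec, mul_apply, sq] using this

lemma frobNorm_mul_le_spectralNormMat_right [DecidableEq n] (A : Matrix m n ℝ) (B : Matrix n n ℝ) :
    frobNorm (A * B) ≤ frobNorm A * spectralNormMat B := by
  rw [← frobNorm_transpose, transpose_mul, mul_comm, ← frobNorm_transpose A,
    ← spectralNormMat_transpose]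
  exact frobNorm_mul_le_spectralNormMat_left _ _

end FrobeniusNorm

/-! ### Positive definite matrices: Fenchel inequality and log det. -/

section PosDef

variable {n : Type*}

lemma Matrix.PosSemidef.isSymm {A : Matrix n n ℝ} (hA : A.PosSemidef) : A.IsSymm :=
  (isHermitian_iff_isSymm).1 hA.1

lemma Matrix.PosDef.convexComb {A B : Matrix n n ℝ} (hA : A.PosDef) (hB : B.PosDef) {a b : ℝ}
    (ha : 0 ≤ a) (hb : 0 ≤ b) (hab : a + b = 1) : (a • A + b • B).PosDef := by
  rcases ha.eq_or_lt with rfl | ha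
  · obtain rfl : b = 1 := by linarith
    simpa using hB
  · exact (hA.smul ha).add_posSemidef (hB.posSemidef.smul hb)

variable [Fintype n]

lemma Matrix.IsSymm.dotProduct_mulVec_comm {A : Matrix n n ℝ} (hA : A.IsSymm) (x y : n → ℝ) :
    x ⬝ᵥ A *ᵥ y = y ⬝ᵥ A *ᵥ x := by
  rw [dotProduct_mulVec, ← mulVec_transpose, hA.eq, dotProduct_comm]

lemma Matrix.PosSemidef.dotProduct_mulVec_self_nonneg {A : Matrix n n ℝ} (hA : A.PosSemidef)
    (x : n → ℝ) : 0 ≤ x ⬝ᵥ A *ᵥ x := by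
  simpa using hA.dotProduct_mulVec_nonneg x

/-- Turns a trace against Z = BᵀB into a sum of quadratic forms over the rows of B, so that vector
inequalities can be applied row by row. -/
lemma trace_transpose_mul_self_mul {m : Type*} [Fintype m] (B : Matrix n n ℝ)
    (M : Matrix m n ℝ) (P : Matrix m m ℝ) :
    (Bᵀ * B * (Mᵀ * P * M)).trace = ∑ k, (M *ᵥ B k) ⬝ᵥ P *ᵥ (M *ᵥ B k) := by
  rw [mul_assoc, trace_mul_comm, trace]
  refine Finset.sum_congr rfl fun k _ => ?_
  have h : (M *ᵥ B k) ⬝ᵥ P *ᵥ (M *ᵥ B k) = B k ⬝ᵥ (Mᵀ * P * M) *ᵥ B k := by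
    rw [← mulVec_mulVec, ← mulVec_mulVec, dotProduct_mulVec (B k), vecMul_transpose]
  rw [h, diag_apply, dotProduct_mulVec, mul_apply]
  simp [dotProduct, vecMul, mul_apply]

variable [DecidableEq n]

lemma Matrix.PosDef.mulVec_inv_mulVec {A : Matrix n n ℝ} (hA : A.PosDef) (x : n → ℝ) :
    A *ᵥ (A⁻¹ *ᵥ x) = x := by
  rw [mulVec_mulVec, mul_nonsing_inv _ ((isUnit_iff_isUnit_det _).1 hA.isUnit), one_mulVec]

/-- Fenchel inequality for the quadratic form of a positive definite matrix. -/
lemma Matrix.PosDef.two_mul_dotProduct_sub_le {A : Matrix n n ℝ} (hA : A.PosDef) (x y : n → ℝ) :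
    2 * (x ⬝ᵥ y) - y ⬝ᵥ A *ᵥ y ≤ x ⬝ᵥ A⁻¹ *ᵥ x := by
  have h := hA.posSemidef.dotProduct_mulVec_self_nonneg (y - A⁻¹ *ᵥ x)
  have h2 := hA.posSemidef.isSymm.dotProduct_mulVec_comm (A⁻¹ *ᵥ x) y
  rw [mulVec_sub, hA.mulVec_inv_mulVec, sub_dotProduct, dotProduct_sub, dotProduct_sub, h2,
    hA.mulVec_inv_mulVec, dotProduct_comm y x, dotProduct_comm _ x] at h
  linarith

lemma Matrix.PosDef.two_mul_dotProduct_sub_eq {A : Matrix n n ℝ} (hA : A.PosDef) (x : n → ℝ) :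
    2 * (x ⬝ᵥ A⁻¹ *ᵥ x) - (A⁻¹ *ᵥ x) ⬝ᵥ A *ᵥ (A⁻¹ *ᵥ x) = x ⬝ᵥ A⁻¹ *ᵥ x := by
  rw [hA.mulVec_inv_mulVec, dotProduct_comm (A⁻¹ *ᵥ x)]
  ring

/-- Joint convexity of `(x, A) ↦ xᵀ A⁻¹ x`. -/
lemma Matrix.PosDef.dotProduct_inv_mulVec_convex {A B : Matrix n n ℝ} (hA : A.PosDef)
    (hB : B.PosDef) (x y : n → ℝ) {a b : ℝ} (ha : 0 ≤ a) (hb : 0 ≤ b) (hab : a + b = 1) :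
    (a • x + b • y) ⬝ᵥ (a • A + b • B)⁻¹ *ᵥ (a • x + b • y)
      ≤ a * (x ⬝ᵥ A⁻¹ *ᵥ x) + b * (y ⬝ᵥ B⁻¹ *ᵥ y) := by
  have hC := hA.convexComb hB ha hb hab
  -- The maximiser in the Fenchel formula for the combined matrix; testing both A and B at this same
  -- vector gives convexity.
  set z := (a • A + b • B)⁻¹ *ᵥ (a • x + b • y)
  have h1 := mul_le_mul_of_nonneg_left (hA.two_mul_dotProduct_sub_le x z) ha
  have h2 := mul_le_mul_of_nonneg_left (hB.two_mul_dotProduct_sub_le y z) hb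
  have h3 := hC.two_mul_dotProduct_sub_eq (a • x + b • y)
  rw [← h3]
  simp only [add_mulVec, smul_mulVec, add_dotProduct, dotProduct_add, smul_dotProduct,
    dotProduct_smul, smul_eq_mul] at h1 h2 ⊢
  linarith

/-- Sum log λ ≤ λ − 1 over the eigenvalues. -/
lemma Matrix.PosDef.log_det_le_trace_sub_card {A : Matrix n n ℝ} (hA : A.PosDef) :
    Real.log A.det ≤ A.trace - Fintype.card n := by
  rw [hA.1.det_eq_prod_eigenvalues, hA.1.trace_eq_sum_eigenvalues]
  simp only [RCLike.ofReal_real_eq_id, id_eq]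
  rw [Real.log_prod fun i _ => (hA.eigenvalues_pos i).ne']
  refine (Finset.sum_le_sum fun i _ => Real.log_le_sub_one_of_pos (hA.eigenvalues_pos i)).trans ?_
  simp

lemma Matrix.PosDef.sqrt {A : Matrix n n ℝ} (hA : A.PosDef) : (CFC.sqrt A).PosDef := by
  have h : CFC.sqrt A * CFC.sqrt A = A := CFC.sqrt_mul_sqrt_self A hA.posSemidef.nonneg
  refine (nonneg_iff_posSemidef.1 (CFC.sqrt_nonneg A)).posDef_iff_det_ne_zero.2 fun h0 => ?_
  have := hA.det_pos
  rw [← h, det_mul, h0] at this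
  simp at this

lemma isSymm_sqrt (A : Matrix n n ℝ) : (CFC.sqrt A).IsSymm :=
  (nonneg_iff_posSemidef.1 (CFC.sqrt_nonneg A)).isSymm

/-- The tangent inequality of the concave function `log det`. -/
lemma Matrix.PosDef.log_det_le_add_trace {A B : Matrix n n ℝ} (hA : A.PosDef) (hB : B.PosDef) :
    Real.log A.det ≤ Real.log B.det + (B⁻¹ * A).trace - Fintype.card n := by
  -- Congruence by B^{-1/2} reduces to tangency at the identity.
  set R := CFC.sqrt B⁻¹
  have hR : R * R = B⁻¹ := CFC.sqrt_mul_sqrt_self _ hB.inv.posSemidef.nonneg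
  have hRA : (R * A * R).PosDef := by
    have := hA.mul_mul_conjTranspose_same (B := R)
      (vecMul_injective_iff_isUnit.2 hB.inv.sqrt.isUnit)
    rwa [conjTranspose_eq_transpose_of_trivial, (isSymm_sqrt B⁻¹).eq] at this
  have h := hRA.log_det_le_trace_sub_card
  have hdet : (R * A * R).det = A.det * B.det⁻¹ := by
    rw [det_mul, det_mul, mul_right_comm, ← det_mul, hR, mul_comm, det_nonsing_inv,
      Ring.inverse_eq_inv']
  rw [trace_mul_comm, ← mul_assoc, hR, hdet, Real.log_mul hA.det_pos.ne'
    (inv_ne_zero hB.det_pos.ne'), Real.log_inv] at h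
  linarith

/-- Both tangent inequalities are taken at the convex combination C, where the weighted traces add
up to tr(C⁻¹C) = n and cancel the dimension. -/
lemma Matrix.PosDef.log_det_concave {A B : Matrix n n ℝ} (hA : A.PosDef) (hB : B.PosDef) {a b : ℝ}
    (ha : 0 ≤ a) (hb : 0 ≤ b) (hab : a + b = 1) :
    a * Real.log A.det + b * Real.log B.det ≤ Real.log (a • A + b • B).det := by
  have hC := hA.convexComb hB ha hb hab
  have h1 := mul_le_mul_of_nonneg_left (hA.log_det_le_add_trace hC) ha
  have h2 := mul_le_mul_of_nonneg_left (hB.log_det_le_add_trace hC) hb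
  have h3 : ((a • A + b • B)⁻¹ * (a • A + b • B)).trace = Fintype.card n := by
    rw [nonsing_inv_mul _ ((isUnit_iff_isUnit_det _).1 hC.isUnit), trace_one]
  rw [mul_add, Matrix.mul_smul, Matrix.mul_smul, trace_add, trace_smul, trace_smul, smul_eq_mul, smul_eq_mul] at h3
  have h4 : b = 1 - a := by linarith
  generalize Real.log (a • A + b • B).det = L at *
  subst h4
  linarith

lemma Matrix.PosSemidef.exists_transpose_mul_self {Z : Matrix n n ℝ} (hZ : Z.PosSemidef) :
    ∃ B : Matrix n n ℝ, Z = Bᵀ * B :=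
  ⟨CFC.sqrt Z, by rw [(isSymm_sqrt Z).eq, CFC.sqrt_mul_sqrt_self _ hZ.nonneg]⟩

end PosDef

/-! ### Geometry of H_γ. -/

section HGamma

variable {d : ℕ} {Θs : Matrix (Fin d) (Fin d) ℝ} {γ : ℝ}

lemma SymMat.isSymm {n : Type*} (H : SymMat n) : (H : Matrix n n ℝ).IsSymm := H.2

lemma Matrix.PosDef.sqrt_mul_sqrt {n : Type*} [Fintype n] [DecidableEq n] {A : Matrix n n ℝ}
    (hA : A.PosDef) : CFC.sqrt A * CFC.sqrt A = A :=
  CFC.sqrt_mul_sqrt_self A hA.posSemidef.nonneg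

lemma sqrt_mulVec_dotProduct_inv (hΘs : Θs.PosDef) (y : Fin d → ℝ) :
    (CFC.sqrt Θs *ᵥ y) ⬝ᵥ Θs⁻¹ *ᵥ (CFC.sqrt Θs *ᵥ y) = y ⬝ᵥ y := by
  have hu := (isUnit_iff_isUnit_det _).1 hΘs.sqrt.isUnit
  have h : Θs⁻¹ *ᵥ (CFC.sqrt Θs *ᵥ y) = (CFC.sqrt Θs)⁻¹ *ᵥ y := by
    rw [mulVec_mulVec]
    nth_rewrite 1 [← hΘs.sqrt_mul_sqrt]
    rw [Matrix.mul_inv_rev, mul_assoc, nonsing_inv_mul _ hu, mul_one]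
  rw [h, dotProduct_comm, dotProduct_mulVec, ← mulVec_transpose, (isSymm_sqrt Θs).eq,
    hΘs.sqrt.mulVec_inv_mulVec]

lemma mem_HGamma_iff_abs_le (hΘs : Θs.PosDef) {H : SymMat (Fin d)} :
    H ∈ HGamma γ Θs ↔ ∀ x : Fin d → ℝ, |x ⬝ᵥ H.1 *ᵥ x| ≤ γ * (x ⬝ᵥ Θs⁻¹ *ᵥ x) := by
  have hs : Θs⁻¹.IsSymm := hΘs.inv.posSemidef.isSymm
  have h1 : (H.1 - -(γ • Θs⁻¹)).IsHermitian :=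
    isHermitian_iff_isSymm.2 ((SymMat.isSymm H).sub (hs.smul γ).neg)
  have h2 : (γ • Θs⁻¹ - H.1).IsHermitian :=
    isHermitian_iff_isSymm.2 ((hs.smul γ).sub (SymMat.isSymm H))
  simp only [HGamma, Set.mem_ofPred_eq, le_iff, posSemidef_iff_dotProduct_mulVec, h1, h2, true_and,
    ← forall_and, star_trivial, sub_mulVec, neg_mulVec, smul_mulVec, dotProduct_sub,
    dotProduct_neg, dotProduct_smul, smul_eq_mul, abs_le]
  refine forall_congr' fun x => ?_
  constructor <;> rintro ⟨h3, h4⟩ <;> constructor <;> linarith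

lemma isSymm_sqrt_mul_mul_sqrt (Θ : Matrix (Fin d) (Fin d) ℝ) (H : SymMat (Fin d)) :
    (CFC.sqrt Θ * H.1 * CFC.sqrt Θ).IsSymm := by
  rw [IsSymm, transpose_mul, transpose_mul, (isSymm_sqrt Θ).eq, (SymMat.isSymm H).eq, mul_assoc]

lemma dotProduct_sqrt_mul_mul_sqrt_mulVec (Θ H : Matrix (Fin d) (Fin d) ℝ) (y : Fin d → ℝ) :
    y ⬝ᵥ (CFC.sqrt Θ * H * CFC.sqrt Θ) *ᵥ y
      = (CFC.sqrt Θ *ᵥ y) ⬝ᵥ H *ᵥ (CFC.sqrt Θ *ᵥ y) := by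
  rw [← mulVec_mulVec, ← mulVec_mulVec, dotProduct_mulVec, ← mulVec_transpose, (isSymm_sqrt Θ).eq]

/-- The substitution x = Θs^{1/2}y turns the form of Θs⁻¹ into |y|² and the Loewner sandwich into a
Rayleigh quotient bound. -/
lemma mem_HGamma_iff_spectralNormMat_le (hΘs : Θs.PosDef) (hγ : 0 ≤ γ) {H : SymMat (Fin d)} :
    H ∈ HGamma γ Θs ↔ spectralNormMat (CFC.sqrt Θs * H.1 * CFC.sqrt Θs) ≤ γ := by
  rw [mem_HGamma_iff_abs_le hΘs]
  refine ⟨fun h => ?_, fun h x => ?_⟩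
  · refine spectralNormMat_le_of_abs_dotProduct_mulVec_le (isSymm_sqrt_mul_mul_sqrt _ _) hγ
      fun y => ?_
    rw [dotProduct_sqrt_mul_mul_sqrt_mulVec, ← sqrt_mulVec_dotProduct_inv hΘs y]
    exact h _
  · obtain ⟨y, rfl⟩ : ∃ y, x = CFC.sqrt Θs *ᵥ y :=
      ⟨_, (hΘs.sqrt.mulVec_inv_mulVec x).symm⟩
    rw [← dotProduct_sqrt_mul_mul_sqrt_mulVec, sqrt_mulVec_dotProduct_inv hΘs]
    refine (abs_dotProduct_mulVec_le _ y).trans (mul_le_mul_of_nonneg_right h ?_)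
    simpa using dotProduct_star_self_nonneg y

/-- The map `H ↦ Θs^{1/2} H Θs^{1/2}` into operators on Euclidean space. -/
noncomputable def sqrtConj (Θs : Matrix (Fin d) (Fin d) ℝ) :
    SymMat (Fin d) →ₗ[ℝ] (EuclideanSpace ℝ (Fin d) →L[ℝ] EuclideanSpace ℝ (Fin d)) where
  toFun H := toEuclideanCLM (𝕜 := ℝ) (CFC.sqrt Θs * H.1 * CFC.sqrt Θs)
  map_add' H K := by simp [mul_add, add_mul]
  map_smul' c H := by simp

/-- As a linear preimage of a ball, H_γ inherits closedness, convexity, symmetry and being a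
neighbourhood of 0. -/
lemma HGamma_eq_preimage (hΘs : Θs.PosDef) (hγ : 0 ≤ γ) :
    HGamma γ Θs = sqrtConj Θs ⁻¹' Metric.closedBall 0 γ := by
  ext H
  rw [mem_HGamma_iff_spectralNormMat_le hΘs hγ, Set.mem_preimage, mem_closedBall_zero_iff]
  rfl

lemma continuous_sqrtConj : Continuous (sqrtConj Θs) :=
  LinearMap.continuous_of_finiteDimensional _

lemma isClosed_HGamma (hΘs : Θs.PosDef) (hγ : 0 ≤ γ) : IsClosed (HGamma γ Θs) := by
  rw [HGamma_eq_preimage hΘs hγ]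
  exact Metric.isClosed_closedBall.preimage continuous_sqrtConj

lemma convex_HGamma (hΘs : Θs.PosDef) (hγ : 0 ≤ γ) : Convex ℝ (HGamma γ Θs) := by
  rw [HGamma_eq_preimage hΘs hγ]
  exact (convex_closedBall 0 γ).linear_preimage _

lemma neg_mem_HGamma (hΘs : Θs.PosDef) (hγ : 0 ≤ γ) {H : SymMat (Fin d)} (hH : H ∈ HGamma γ Θs) :
    -H ∈ HGamma γ Θs := by
  rw [HGamma_eq_preimage hΘs hγ, Set.mem_preimage, mem_closedBall_zero_iff] at hH ⊢
  rwa [map_neg, norm_neg]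

lemma HGamma_mem_nhds_zero (hΘs : Θs.PosDef) (hγ : 0 < γ) : HGamma γ Θs ∈ nhds 0 := by
  rw [HGamma_eq_preimage hΘs hγ.le]
  refine continuous_sqrtConj.continuousAt.preimage_mem_nhds ?_
  rw [map_zero]
  exact Metric.closedBall_mem_nhds 0 hγ

/-- Conjugation by Θs^{-1/2} undoes `sqrtConj`, so H_γ is a closed subset of a continuous image of a
compact ball. -/
lemma isCompact_HGamma (hΘs : Θs.PosDef) (hγ : 0 ≤ γ) : IsCompact (HGamma γ Θs) := by
  have hu := (isUnit_iff_isUnit_det _).1 hΘs.sqrt.isUnit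
  set g : (EuclideanSpace ℝ (Fin d) →L[ℝ] EuclideanSpace ℝ (Fin d)) →ₗ[ℝ]
      Matrix (Fin d) (Fin d) ℝ := (toEuclideanCLM (n := Fin d) (𝕜 := ℝ)).symm.toAlgEquiv.toLinearMap
  have hg : Continuous g := LinearMap.continuous_of_finiteDimensional _
  have hK : IsCompact ((fun T => (CFC.sqrt Θs)⁻¹ * g T * (CFC.sqrt Θs)⁻¹) ''
      Metric.closedBall 0 γ) :=
    (isCompact_closedBall 0 γ).image (by fun_prop)
  have hcl : Topology.IsClosedEmbedding (Subtype.val : SymMat (Fin d) → _) :=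
    (Submodule.closed_of_finiteDimensional (SymMat (Fin d))).isClosedEmbedding_subtypeVal
  refine (hcl.isCompact_preimage hK).of_isClosed_subset (isClosed_HGamma hΘs hγ) fun H hH => ?_
  rw [HGamma_eq_preimage hΘs hγ] at hH
  refine ⟨_, hH, ?_⟩
  have : g (sqrtConj Θs H) = CFC.sqrt Θs * H.1 * CFC.sqrt Θs :=
    (toEuclideanCLM (n := Fin d) (𝕜 := ℝ)).symm_apply_apply _
  simp only [this]
  rw [mul_assoc, mul_assoc, mul_nonsing_inv _ hu, mul_one, ← mul_assoc, nonsing_inv_mul _ hu,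
    one_mul]

lemma posDef_inv_sub_of_mem_HGamma (hΘs : Θs.PosDef) (hγ : γ < 1) {H : SymMat (Fin d)}
    (hH : H ∈ HGamma γ Θs) : (Θs⁻¹ - H.1).PosDef := by
  refine PosDef.of_dotProduct_mulVec_pos
    (isHermitian_iff_isSymm.2 (hΘs.inv.posSemidef.isSymm.sub (SymMat.isSymm H))) fun x hx => ?_
  have h1 := (abs_le.1 ((mem_HGamma_iff_abs_le hΘs).1 hH x)).2
  have h2 := hΘs.inv.dotProduct_mulVec_pos hx
  simp only [star_trivial, sub_mulVec, dotProduct_sub] at h2 ⊢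
  nlinarith

lemma posDef_one_sub_of_mem_HGamma (hΘs : Θs.PosDef) (hγ0 : 0 ≤ γ) (hγ : γ < 1)
    {H : SymMat (Fin d)} (hH : H ∈ HGamma γ Θs) :
    (1 - CFC.sqrt Θs * H.1 * CFC.sqrt Θs).PosDef :=
  posDef_one_sub_of_spectralNormMat_lt_one (isSymm_sqrt_mul_mul_sqrt _ _)
    (((mem_HGamma_iff_spectralNormMat_le hΘs hγ0).1 hH).trans_lt hγ)

end HGamma

/-! ### Continuity of the Frobenius norm and the matrix inverse. -/

section Continuity

variable {X m n : Type*} [TopologicalSpace X] [Fintype m] [Fintype n]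

lemma Continuous.frobNorm {f : X → Matrix m n ℝ} (hf : Continuous f) :
    Continuous fun x => frobNorm (f x) := by
  have h (i : m) (j : n) : Continuous fun x => f x i j := hf.matrix_elem i j
  unfold _root_.frobNorm
  fun_prop

lemma ContinuousOn.matrix_inv [DecidableEq n] {f : X → Matrix n n ℝ} {s : Set X}
    (hf : ContinuousOn f s) (h : ∀ x ∈ s, (f x).det ≠ 0) : ContinuousOn (fun x => (f x)⁻¹) s := by
  simp only [inv_def, Ring.inverse_eq_inv']
  rw [continuousOn_iff_continuous_domRestrict] at hf ⊢
  exact (hf.matrix_det.inv₀ fun x => h x x.2).smul hf.matrix_adjugate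

end Continuity

/-! ### Regular data: convexity, affinity and continuity of Φ. -/

section Convexity

variable {d : ℕ} {Θs : Matrix (Fin d) (Fin d) ℝ} {γ δ : ℝ}

/-- f²/(1 − s) is the maximum over τ of 2τf − τ²(1 − s), affine in (f, s). The maximiser τ = f/(1 −
s) is nonnegative, so this expression increases with f and s, and upper bounds on both suffice. -/
lemma sq_div_one_sub_convex {f f₁ f₂ s s₁ s₂ a b : ℝ} (hf0 : 0 ≤ f) (hs : s < 1) (hs₁ : s₁ < 1)
    (hs₂ : s₂ < 1) (ha : 0 ≤ a) (hb : 0 ≤ b) (hab : a + b = 1) (hf : f ≤ a * f₁ + b * f₂)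
    (hsle : s ≤ a * s₁ + b * s₂) :
    f ^ 2 / (1 - s) ≤ a * (f₁ ^ 2 / (1 - s₁)) + b * (f₂ ^ 2 / (1 - s₂)) := by
  have key (τ g t : ℝ) (ht : t < 1) : 2 * τ * g - τ ^ 2 * (1 - t) ≤ g ^ 2 / (1 - t) := by
    rw [le_div_iff₀ (by linarith)]
    nlinarith [sq_nonneg (g - τ * (1 - t))]
  set τ := f / (1 - s) with hτ
  have hs' : 0 < 1 - s := by linarith
  have hτ0 : 0 ≤ τ := div_nonneg hf0 hs'.le
  have h1 := mul_le_mul_of_nonneg_left (key τ f₁ s₁ hs₁) ha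
  have h2 := mul_le_mul_of_nonneg_left (key τ f₂ s₂ hs₂) hb
  have h3 : f ^ 2 / (1 - s) = 2 * τ * f - τ ^ 2 * (1 - s) := by
    rw [hτ]
    field_simp
    ring
  have h4 := mul_le_mul_of_nonneg_left hf hτ0
  have h5 := mul_le_mul_of_nonneg_left hsle (sq_nonneg τ)
  have h6 : τ ^ 2 * (a + b) = τ ^ 2 := by rw [hab, mul_one]
  rw [h3]
  linarith

lemma convexOn_Upsilon (hΘs : Θs.PosDef) (hγ0 : 0 ≤ γ) (hγ : γ < 1) (hδ : 0 ≤ δ)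
    (Θ : Matrix (Fin d) (Fin d) ℝ) :
    ConvexOn ℝ (HGamma γ Θs) (fun H : SymMat (Fin d) => Upsilon Θs δ H Θ) := by
  refine ⟨convex_HGamma hΘs hγ0, fun H hH K hK a b ha hb hab => ?_⟩
  have hHK := convex_HGamma hΘs hγ0 hH hK ha hb hab
  have hlt {H : SymMat (Fin d)} (hH : H ∈ HGamma γ Θs) :=
    ((mem_HGamma_iff_spectralNormMat_le hΘs hγ0).1 hH).trans_lt hγ
  have hX : CFC.sqrt Θs * (a • H + b • K : SymMat (Fin d)).1 * CFC.sqrt Θs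
      = a • (CFC.sqrt Θs * H.1 * CFC.sqrt Θs) + b • (CFC.sqrt Θs * K.1 * CFC.sqrt Θs) := by
    simp [mul_add, add_mul]
  have hdet := (posDef_one_sub_of_mem_HGamma hΘs hγ0 hγ hH).log_det_concave
    (posDef_one_sub_of_mem_HGamma hΘs hγ0 hγ hK) ha hb hab
  have hone : a • (1 - CFC.sqrt Θs * H.1 * CFC.sqrt Θs) + b • (1 - CFC.sqrt Θs * K.1 * CFC.sqrt Θs)
      = 1 - CFC.sqrt Θs * (a • H + b • K : SymMat (Fin d)).1 * CFC.sqrt Θs := by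
    rw [hX, smul_sub, smul_sub, ← add_sub_add_comm, ← add_smul, hab, one_smul]
  rw [hone] at hdet
  have hf : frobNorm (CFC.sqrt Θs * (a • H + b • K : SymMat (Fin d)).1 * CFC.sqrt Θs)
      ≤ a * frobNorm (CFC.sqrt Θs * H.1 * CFC.sqrt Θs)
        + b * frobNorm (CFC.sqrt Θs * K.1 * CFC.sqrt Θs) := by
    rw [hX]
    refine (frobNorm_add_le _ _).trans_eq ?_
    rw [frobNorm_smul, frobNorm_smul, abs_of_nonneg ha, abs_of_nonneg hb]
  have hs : spectralNormMat (CFC.sqrt Θs * (a • H + b • K : SymMat (Fin d)).1 * CFC.sqrt Θs)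
      ≤ a * spectralNormMat (CFC.sqrt Θs * H.1 * CFC.sqrt Θs)
        + b * spectralNormMat (CFC.sqrt Θs * K.1 * CFC.sqrt Θs) :=
    (convexOn_univ_norm.comp_linearMap (sqrtConj Θs)).2 (Set.mem_univ H) (Set.mem_univ K) ha hb hab
  have hq := mul_le_mul_of_nonneg_left (sq_div_one_sub_convex (frobNorm_nonneg _) (hlt hHK)
    (hlt hH) (hlt hK) ha hb hab hf hs) (show 0 ≤ δ * (2 + δ) / 2 by positivity)
  have htr : ((Θ - Θs) * (a • H + b • K : SymMat (Fin d)).1).trace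
      = a * ((Θ - Θs) * H.1).trace + b * ((Θ - Θs) * K.1).trace := by
    simp [mul_add]
  have hdiv (f s : ℝ) : δ * (2 + δ) / (2 * (1 - s)) * f ^ 2 = δ * (2 + δ) / 2 * (f ^ 2 / (1 - s)) := by
    rw [div_mul_eq_div_div]
    ring
  simp only [Upsilon, hdiv, smul_eq_mul, htr]
  linarith

lemma appendCol_comb (a b : ℝ) (h k : EuclideanSpace ℝ (Fin d)) (H K : Matrix (Fin d) (Fin d) ℝ) :
    appendCol (a • h + b • k) (a • H + b • K) = a • appendCol h H + b • appendCol k K := by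
  ext i (j | j) <;> simp [appendCol]

lemma borderedMat_comb (a b : ℝ) (h k : EuclideanSpace ℝ (Fin d))
    (H K : Matrix (Fin d) (Fin d) ℝ) :
    borderedMat (a • h + b • k) (a • H + b • K) = a • borderedMat h H + b • borderedMat k K := by
  ext (i | i) (j | j) <;> simp [borderedMat]

lemma GammaFun_transpose_mul_self (h : EuclideanSpace ℝ (Fin d)) (H : Matrix (Fin d) (Fin d) ℝ)
    (B : Matrix (Fin d ⊕ Unit) (Fin d ⊕ Unit) ℝ) :
    GammaFun Θs h H (Bᵀ * B) = 1 / 2 * ((Bᵀ * B * borderedMat h H).trace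
      + ∑ k, (appendCol h H *ᵥ B k) ⬝ᵥ (Θs⁻¹ - H)⁻¹ *ᵥ (appendCol h H *ᵥ B k)) := by
  rw [GammaFun, mul_add, trace_add, trace_transpose_mul_self_mul]

lemma convexOn_GammaFun (hΘs : Θs.PosDef) (hγ0 : 0 ≤ γ) (hγ : γ < 1)
    {Z : Matrix (Fin d ⊕ Unit) (Fin d ⊕ Unit) ℝ} (hZ : Z.PosSemidef) :
    ConvexOn ℝ ((Set.univ : Set (EuclideanSpace ℝ (Fin d))) ×ˢ HGamma γ Θs)
      (fun p => GammaFun Θs p.1 p.2 Z) := by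
  refine ⟨convex_univ.prod (convex_HGamma hΘs hγ0), ?_⟩
  rintro ⟨h, H⟩ ⟨-, hH⟩ ⟨k, K⟩ ⟨-, hK⟩ a b ha hb hab
  obtain ⟨B, rfl⟩ := hZ.exists_transpose_mul_self
  simp only [GammaFun_transpose_mul_self, smul_eq_mul, Prod.smul_mk, Prod.mk_add_mk,
    Submodule.coe_add, Submodule.coe_smul, appendCol_comb, borderedMat_comb, mul_add, trace_add,
    Matrix.mul_smul, trace_smul]
  have hsum := Finset.sum_le_sum fun (i : Fin d ⊕ Unit) (_ : i ∈ Finset.univ) =>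
    (posDef_inv_sub_of_mem_HGamma hΘs hγ hH).dotProduct_inv_mulVec_convex
      (posDef_inv_sub_of_mem_HGamma hΘs hγ hK) (appendCol h H.1 *ᵥ B i) (appendCol k K.1 *ᵥ B i)
      ha hb hab
  have hP : a • (Θs⁻¹ - H.1) + b • (Θs⁻¹ - K.1) = Θs⁻¹ - (a • H.1 + b • K.1) := by
    rw [smul_sub, smul_sub, ← add_sub_add_comm, ← add_smul, hab, one_smul]
  rw [Finset.sum_add_distrib, ← Finset.mul_sum, ← Finset.mul_sum, hP] at hsum
  simp only [add_mulVec, smul_mulVec]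
  linarith

lemma convexOn_PhiFun (hΘs : Θs.PosDef) (hγ0 : 0 ≤ γ) (hγ : γ < 1) (hδ : 0 ≤ δ)
    {μ : SymMat (Fin d) × SymMat (Fin d ⊕ Unit)} (hμ : μ.2 ∈ ZPlus d) :
    ConvexOn ℝ ((Set.univ : Set (EuclideanSpace ℝ (Fin d))) ×ˢ HGamma γ Θs)
      (fun p => PhiFun Θs δ p μ) := by
  have h := (convexOn_Upsilon hΘs hγ0 hγ hδ μ.1.1).comp_linearMap
    (LinearMap.snd ℝ (EuclideanSpace ℝ (Fin d)) (SymMat (Fin d)))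
  have hset : LinearMap.snd ℝ (EuclideanSpace ℝ (Fin d)) (SymMat (Fin d)) ⁻¹' HGamma γ Θs
      = Set.univ ×ˢ HGamma γ Θs := by
    ext
    simp
  rw [hset] at h
  exact h.add (convexOn_GammaFun hΘs hγ0 hγ hμ.1)

/-- Φ is affine in (Θ, Z), which is more than the required concavity. -/
lemma PhiFun_convexComb_right (p : EuclideanSpace ℝ (Fin d) × SymMat (Fin d))
    (μ ν : SymMat (Fin d) × SymMat (Fin d ⊕ Unit)) {a b : ℝ} (hab : a + b = 1) :
    PhiFun Θs δ p (a • μ + b • ν) = a * PhiFun Θs δ p μ + b * PhiFun Θs δ p ν := by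
  obtain rfl : b = 1 - a := by linarith
  simp only [PhiFun, Upsilon, GammaFun, Prod.fst_add, Prod.snd_add, Prod.smul_fst, Prod.smul_snd,
    Submodule.coe_add, Submodule.coe_smul, add_mul, sub_mul, trace_add, trace_sub, smul_mul,
    trace_smul, smul_eq_mul]
  ring

lemma convex_ZPlus : Convex ℝ (ZPlus d) := by
  intro Z hZ W hW a b ha hb hab
  refine ⟨(hZ.1.smul ha).add (hW.1.smul hb), ?_⟩
  have h1 := hZ.2
  have h2 := hW.2
  simp only [Submodule.coe_add, Submodule.coe_smul, Matrix.add_apply, Matrix.smul_apply, h1, h2, smul_eq_mul]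
  linarith

lemma isClosed_ZPlus : IsClosed (ZPlus d) := by
  have hval : Continuous (Subtype.val : SymMat (Fin d ⊕ Unit) → _) := continuous_subtype_val
  have heq : ZPlus d = (⋂ x : Fin d ⊕ Unit → ℝ, {Z : SymMat (Fin d ⊕ Unit) | 0 ≤ x ⬝ᵥ Z.1 *ᵥ x})
      ∩ {Z | Z.1 (Sum.inr ()) (Sum.inr ()) = 1} := by
    ext Z
    simp [ZPlus, posSemidef_iff_dotProduct_mulVec, isHermitian_iff_isSymm, SymMat.isSymm Z]
  rw [heq]
  refine (isClosed_iInter fun x => isClosed_le continuous_const ?_).inter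
    (isClosed_eq (hval.matrix_elem _ _) continuous_const)
  exact continuous_const.dotProduct (hval.matrix_mulVec continuous_const)

lemma continuousOn_Upsilon (hΘs : Θs.PosDef) (hγ0 : 0 ≤ γ) (hγ : γ < 1) :
    ContinuousOn (fun q : SymMat (Fin d) × SymMat (Fin d) => Upsilon Θs δ q.1 q.2)
      (HGamma γ Θs ×ˢ Set.univ) := by
  have hval : Continuous (Subtype.val : SymMat (Fin d) → _) := continuous_subtype_val
  have hX : Continuous fun q : SymMat (Fin d) × SymMat (Fin d) =>
      CFC.sqrt Θs * q.1.1 * CFC.sqrt Θs := by fun_prop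
  have hs : Continuous fun q : SymMat (Fin d) × SymMat (Fin d) =>
      spectralNormMat (CFC.sqrt Θs * q.1.1 * CFC.sqrt Θs) :=
    (continuous_sqrtConj (Θs := Θs)).norm.comp continuous_fst
  have hlog : ContinuousOn (fun q : SymMat (Fin d) × SymMat (Fin d) =>
      Real.log (1 - CFC.sqrt Θs * q.1.1 * CFC.sqrt Θs).det) (HGamma γ Θs ×ˢ Set.univ) :=
    (continuous_const.sub hX).matrix_det.continuousOn.log fun q hq =>
      (posDef_one_sub_of_mem_HGamma hΘs hγ0 hγ hq.1).det_pos.ne'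
  have htr : Continuous fun q : SymMat (Fin d) × SymMat (Fin d) =>
      ((q.2.1 - Θs) * q.1.1).trace :=
    Continuous.matrix_trace (by fun_prop)
  refine ((continuousOn_const.mul hlog).add (continuousOn_const.mul htr.continuousOn)).add
    ((continuousOn_const.div
      (continuousOn_const.mul (continuousOn_const.sub hs.continuousOn)) fun q hq => ?_).mul
      (hX.frobNorm.continuousOn.pow 2))
  have := ((mem_HGamma_iff_spectralNormMat_le hΘs hγ0).1 hq.1).trans_lt hγ
  exact mul_ne_zero two_ne_zero (sub_pos.2 this).ne'

lemma continuous_appendCol :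
    Continuous fun p : EuclideanSpace ℝ (Fin d) × SymMat (Fin d) => appendCol p.1 p.2.1 := by
  have hval : Continuous (Subtype.val : SymMat (Fin d) → _) := continuous_subtype_val
  refine continuous_matrix fun i j => ?_
  rcases j with j | j
  · exact (hval.comp continuous_snd).matrix_elem i j
  · change Continuous fun p : EuclideanSpace ℝ (Fin d) × SymMat (Fin d) => p.1 i
    fun_prop

lemma continuous_borderedMat :
    Continuous fun p : EuclideanSpace ℝ (Fin d) × SymMat (Fin d) => borderedMat p.1 p.2.1 := by
  have hval : Continuous (Subtype.val : SymMat (Fin d) → _) := continuous_subtype_val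
  refine continuous_matrix fun i j => ?_
  rcases i with i | i <;> rcases j with j | j
  · exact (hval.comp continuous_snd).matrix_elem i j
  · change Continuous fun p : EuclideanSpace ℝ (Fin d) × SymMat (Fin d) => p.1 i
    fun_prop
  · change Continuous fun p : EuclideanSpace ℝ (Fin d) × SymMat (Fin d) => p.1 j
    fun_prop
  · exact continuous_const

lemma continuousOn_GammaFun (hΘs : Θs.PosDef) (hγ : γ < 1) :
    ContinuousOn (fun q : (EuclideanSpace ℝ (Fin d) × SymMat (Fin d)) × SymMat (Fin d ⊕ Unit) =>
      GammaFun Θs q.1.1 q.1.2 q.2) ((Set.univ ×ˢ HGamma γ Θs) ×ˢ Set.univ) := by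
  have hval : Continuous (Subtype.val : SymMat (Fin d) → _) := continuous_subtype_val
  have hval' : Continuous (Subtype.val : SymMat (Fin d ⊕ Unit) → _) := continuous_subtype_val
  have hinv : ContinuousOn
      (fun q : (EuclideanSpace ℝ (Fin d) × SymMat (Fin d)) × SymMat (Fin d ⊕ Unit) =>
        (Θs⁻¹ - q.1.2.1)⁻¹) ((Set.univ ×ˢ HGamma γ Θs) ×ˢ Set.univ) :=
    ContinuousOn.matrix_inv (by fun_prop) fun q hq =>
      (posDef_inv_sub_of_mem_HGamma hΘs hγ hq.1.2).det_pos.ne'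
  have hA := continuous_appendCol.comp
    (continuous_fst (X := EuclideanSpace ℝ (Fin d) × SymMat (Fin d)) (Y := SymMat (Fin d ⊕ Unit)))
  have hB := continuous_borderedMat.comp
    (continuous_fst (X := EuclideanSpace ℝ (Fin d) × SymMat (Fin d)) (Y := SymMat (Fin d ⊕ Unit)))
  simp only [Function.comp_def] at hA hB
  rw [continuousOn_iff_continuous_domRestrict] at hinv ⊢
  have hcoe : Continuous (Subtype.val : ((Set.univ : Set (EuclideanSpace ℝ (Fin d))) ×ˢ
    HGamma γ Θs) ×ˢ (Set.univ : Set (SymMat (Fin d ⊕ Unit))) → _) := continuous_subtype_val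
  exact continuous_const.mul (((hval'.comp (continuous_snd.comp hcoe)).matrix_mul
    ((hB.comp hcoe).add ((((hA.comp hcoe).matrix_transpose).matrix_mul hinv).matrix_mul
      (hA.comp hcoe)))).matrix_trace)

lemma continuousOn_PhiFun (hΘs : Θs.PosDef) (hγ0 : 0 ≤ γ) (hγ : γ < 1)
    (M : Set (SymMat (Fin d) × SymMat (Fin d ⊕ Unit))) :
    ContinuousOn (fun q : (EuclideanSpace ℝ (Fin d) × SymMat (Fin d)) ×
      (SymMat (Fin d) × SymMat (Fin d ⊕ Unit)) => PhiFun Θs δ q.1 q.2)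
      ((Set.univ ×ˢ HGamma γ Θs) ×ˢ M) := by
  have hU : Continuous (fun q : (EuclideanSpace ℝ (Fin d) × SymMat (Fin d)) ×
      (SymMat (Fin d) × SymMat (Fin d ⊕ Unit)) => (q.1.2, q.2.1)) := by fun_prop
  have hG : Continuous (fun q : (EuclideanSpace ℝ (Fin d) × SymMat (Fin d)) ×
      (SymMat (Fin d) × SymMat (Fin d ⊕ Unit)) => (q.1, q.2.2)) := by fun_prop
  have h1 := (continuousOn_Upsilon (δ := δ) hΘs hγ0 hγ).comp
    (hU.continuousOn (s := (Set.univ ×ˢ HGamma γ Θs) ×ˢ M)) fun q hq => ⟨hq.1.2, trivial⟩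
  have h2 := (continuousOn_GammaFun hΘs hγ).comp
    (hG.continuousOn (s := (Set.univ ×ˢ HGamma γ Θs) ×ˢ M)) fun q hq => ⟨hq.1, trivial⟩
  exact h1.add h2

lemma isRegularData_PhiFun {V : Set (SymMat (Fin d))} (hVconv : Convex ℝ V) (hVcl : IsClosed V)
    (hΘs : Θs.PosDef) (hγ0 : 0 < γ) (hγ : γ < 1) (hδ : 0 ≤ δ) :
    IsRegularData ((Set.univ : Set (EuclideanSpace ℝ (Fin d))) ×ˢ HGamma γ Θs)
        (V ×ˢ ZPlus d) (PhiFun Θs δ) where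
  isClosed_left := isClosed_univ.prod (isClosed_HGamma hΘs hγ0.le)
  convex_left := convex_univ.prod (convex_HGamma hΘs hγ0.le)
  symmetric_left _ hp := ⟨trivial, neg_mem_HGamma hΘs hγ0.le hp.2⟩
  zero_mem_interior := mem_interior_iff_mem_nhds.2
    (prod_mem_nhds Filter.univ_mem (HGamma_mem_nhds_zero hΘs hγ0))
  isClosed_right := hVcl.prod isClosed_ZPlus
  convex_right := hVconv.prod convex_ZPlus
  continuousOn := continuousOn_PhiFun hΘs hγ0.le hγ _
  convexOn _ hμ := convexOn_PhiFun hΘs hγ0.le hγ hδ hμ.2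
  concaveOn _ _ := ⟨hVconv.prod convex_ZPlus, fun μ _ ν _ _ _ _ _ hab =>
    (PhiFun_convexComb_right _ μ ν hab).ge⟩

end Convexity

/-! ### Gaussian moments of exponentials of quadratic forms. -/

section GaussianIntegral

lemma integral_exp_quadratic_gaussianReal {l : ℝ} (hl : l < 1) (b : ℝ) :
    ∫ x, Real.exp (b * x + 1 / 2 * (l * x ^ 2)) ∂(gaussianReal 0 1)
      = (√(1 - l))⁻¹ * Real.exp (1 / 2 * (b ^ 2 / (1 - l))) := by
  have hl' : 0 < 1 - l := by linarith
  set v : NNReal := ⟨(1 - l)⁻¹, (inv_pos.2 hl').le⟩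
  have hv : (v : ℝ) = (1 - l)⁻¹ := rfl
  have hv0 : v ≠ 0 := fun h => (inv_pos.2 hl').ne' (by rw [← hv, h]; rfl)
  rw [integral_gaussianReal_eq_integral_smul one_ne_zero]
  -- Completing the square: the integrand is a multiple of the Gaussian density with mean b/(1 − l)
  -- and variance 1/(1 − l).
  have key (x : ℝ) : gaussianPDFReal 0 1 x • Real.exp (b * x + 1 / 2 * (l * x ^ 2))
      = (√(1 - l))⁻¹ * Real.exp (1 / 2 * (b ^ 2 / (1 - l))) *
        gaussianPDFReal (b / (1 - l)) v x := by
    have h1 : √(2 * Real.pi * (1 - l)⁻¹) = √(2 * Real.pi) * (√(1 - l))⁻¹ := by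
      rw [Real.sqrt_mul (by positivity), Real.sqrt_inv]
    have h2 : √(1 - l) ≠ 0 := (Real.sqrt_pos.2 hl').ne'
    have h3 : Real.exp (-(x - 0) ^ 2 / (2 * ((1 : NNReal) : ℝ))) *
        Real.exp (b * x + 1 / 2 * (l * x ^ 2))
        = Real.exp (1 / 2 * (b ^ 2 / (1 - l))) *
          Real.exp (-(x - b / (1 - l)) ^ 2 / (2 * (1 - l)⁻¹)) := by
      rw [← Real.exp_add, ← Real.exp_add]
      congr 1
      simp only [NNReal.coe_one]
      field_simp
      ring
    rw [gaussianPDFReal_def, gaussianPDFReal_def, smul_eq_mul, hv, h1, mul_assoc, h3]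
    simp only [NNReal.coe_one, mul_one]
    field_simp
  simp_rw [key]
  rw [integral_const_mul, integral_gaussianPDFReal_eq_one _ hv0, mul_one]

variable {n : Type*} [Fintype n] [DecidableEq n]

lemma Matrix.IsHermitian.toEuclideanCLM_eigenvectorBasis {S : Matrix n n ℝ} (hS : S.IsHermitian)
    (i : n) : toEuclideanCLM (𝕜 := ℝ) S (hS.eigenvectorBasis i)
      = hS.eigenvalues i • hS.eigenvectorBasis i :=
  WithLp.ofLp_injective 2 (hS.mulVec_eigenvectorBasis i)

/-- Evaluate the characteristic polynomial at 1. -/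
lemma Matrix.IsHermitian.det_one_sub {S : Matrix n n ℝ} (hS : S.IsHermitian) :
    (1 - S).det = ∏ i, (1 - hS.eigenvalues i) := by
  have h := congrArg (Polynomial.eval 1) hS.charpoly_eq
  rw [eval_charpoly, Polynomial.eval_prod] at h
  simpa using h

lemma Matrix.IsHermitian.inner_eigenvectorBasis_one_sub_mulVec {S : Matrix n n ℝ}
    (hS : S.IsHermitian) (w : EuclideanSpace ℝ n) (i : n) :
    inner ℝ (hS.eigenvectorBasis i) (toEuclideanCLM (𝕜 := ℝ) (1 - S) w)
      = (1 - hS.eigenvalues i) * inner ℝ (hS.eigenvectorBasis i) w := by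
  have h : inner ℝ (hS.eigenvectorBasis i) (toEuclideanCLM (𝕜 := ℝ) S w)
      = hS.eigenvalues i * inner ℝ (hS.eigenvectorBasis i) w := by
    rw [← real_inner_smul_left, ← hS.toEuclideanCLM_eigenvectorBasis, inner_toEuclideanCLM,
      real_inner_comm, inner_toEuclideanCLM, (isHermitian_iff_isSymm.1 hS).dotProduct_mulVec_comm]
  rw [map_sub, map_one, _root_.sub_apply, inner_sub_right, h, sub_mul, one_mul]
  rfl

lemma Matrix.IsHermitian.eigenvalues_lt_one {S : Matrix n n ℝ} (hS : S.IsHermitian)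
    (h1 : (1 - S).PosDef) (i : n) : hS.eigenvalues i < 1 := by
  have h := hS.inner_eigenvectorBasis_one_sub_mulVec (hS.eigenvectorBasis i) i
  have hne : (hS.eigenvectorBasis i).ofLp ≠ 0 := fun h0 =>
    hS.eigenvectorBasis.orthonormal.ne_zero i (WithLp.ofLp_injective 2 h0)
  have h2 := h1.dotProduct_mulVec_pos hne
  rw [inner_toEuclideanCLM, real_inner_self_eq_norm_sq, hS.eigenvectorBasis.orthonormal.1] at h
  rw [star_trivial, h] at h2
  linarith

/-- The moment generating function of a linear plus quadratic form of a standard Gaussian vector. -/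
lemma integral_exp_quadratic_stdGaussian {S : Matrix n n ℝ} (hS : S.IsSymm) (h1 : (1 - S).PosDef)
    (b : n → ℝ) :
    ∫ x : EuclideanSpace ℝ n, Real.exp (b ⬝ᵥ x.ofLp + 1 / 2 * (x.ofLp ⬝ᵥ S *ᵥ x.ofLp))
        ∂(stdGaussian (EuclideanSpace ℝ n))
      = (√(1 - S).det)⁻¹ * Real.exp (1 / 2 * (b ⬝ᵥ (1 - S)⁻¹ *ᵥ b)) := by
  have hH : S.IsHermitian := isHermitian_iff_isSymm.2 hS
  set e := hH.eigenvectorBasis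
  set c : n → ℝ := fun i => inner ℝ (WithLp.toLp 2 b) (e i)
  have hexp (x : n → ℝ) : Real.exp (b ⬝ᵥ (∑ i, x i • e i).ofLp
        + 1 / 2 * ((∑ i, x i • e i).ofLp ⬝ᵥ S *ᵥ (∑ i, x i • e i).ofLp))
      = ∏ i, Real.exp (c i * x i + 1 / 2 * (hH.eigenvalues i * x i ^ 2)) := by
    rw [← Real.exp_sum, Finset.sum_add_distrib, ← Finset.mul_sum]
    have hlin : b ⬝ᵥ (∑ i, x i • e i).ofLp = ∑ i, c i * x i := by
      have : b ⬝ᵥ (∑ i, x i • e i).ofLp = inner ℝ (WithLp.toLp 2 b) (∑ i, x i • e i) := by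
        simp [PiLp.inner_apply, dotProduct, mul_comm]
      rw [this, inner_sum]
      exact Finset.sum_congr rfl fun i _ => by rw [real_inner_smul_right, mul_comm]
    have hquad : (∑ i, x i • e i).ofLp ⬝ᵥ S *ᵥ (∑ i, x i • e i).ofLp
        = ∑ i, hH.eigenvalues i * x i ^ 2 := by
      rw [← inner_toEuclideanCLM, map_sum]
      simp_rw [map_smul, e, hH.toEuclideanCLM_eigenvectorBasis, smul_smul]
      rw [hH.eigenvectorBasis.orthonormal.inner_sum]
      exact Finset.sum_congr rfl fun i _ => by
        simp only [conj_trivial]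
        ring
    rw [hlin, hquad]
  -- By rotation invariance the coordinates in the eigenbasis of S are independent standard
  -- Gaussians, so the integral factors.
  rw [stdGaussian_eq_map_pi_orthonormalBasis e, integral_map (Measurable.aemeasurable (by fun_prop))
    (Measurable.aestronglyMeasurable (by simp only [dotProduct, mulVec]; fun_prop))]
  simp_rw [hexp]
  rw [integral_fintype_prod_eq_prod
    (f := fun i t => Real.exp (c i * t + 1 / 2 * (hH.eigenvalues i * t ^ 2)))]
  simp_rw [integral_exp_quadratic_gaussianReal (hH.eigenvalues_lt_one h1 _)]
  rw [Finset.prod_mul_distrib, ← Real.exp_sum, hH.det_one_sub, Finset.prod_inv_distrib,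
    Real.sqrt_prod _ fun i _ => sub_nonneg.2 (hH.eigenvalues_lt_one h1 i).le, ← Finset.mul_sum]
  have hquad : b ⬝ᵥ (1 - S)⁻¹ *ᵥ b = ∑ i, c i ^ 2 / (1 - hH.eigenvalues i) := by
    have hw (i : n) : c i = (1 - hH.eigenvalues i)
        * inner ℝ (e i) (WithLp.toLp 2 ((1 - S)⁻¹ *ᵥ b)) := by
      rw [← hH.inner_eigenvectorBasis_one_sub_mulVec, toEuclideanCLM_toLp, h1.mulVec_inv_mulVec]
      exact real_inner_comm _ _
    have : b ⬝ᵥ (1 - S)⁻¹ *ᵥ b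
        = inner ℝ (WithLp.toLp 2 b) (WithLp.toLp 2 ((1 - S)⁻¹ *ᵥ b)) := by
      simp [PiLp.inner_apply, dotProduct, mul_comm]
    rw [this, ← e.sum_inner_mul_inner]
    refine Finset.sum_congr rfl fun i _ => ?_
    have hpos := sub_pos.2 (hH.eigenvalues_lt_one h1 i)
    change c i * _ = _
    rw [sq, hw i]
    field_simp
  rw [hquad]

end GaussianIntegral

/-! ### Perturbation of log det under a near-identity contraction. -/

section LogDet

variable {n : Type*} [Fintype n] [DecidableEq n]

lemma frobNorm_conj_le {X Q : Matrix n n ℝ} (hQ : spectralNormMat Q ≤ 1) :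
    frobNorm (Q * X * Qᵀ) ≤ frobNorm X := by
  refine (frobNorm_mul_le_spectralNormMat_right _ _).trans ?_
  rw [spectralNormMat_transpose]
  refine (mul_le_of_le_one_right (frobNorm_nonneg _) hQ).trans ?_
  exact (frobNorm_mul_le_spectralNormMat_left _ _).trans
    (mul_le_of_le_one_left (frobNorm_nonneg _) hQ)

lemma spectralNormMat_conj_le {X Q : Matrix n n ℝ} (hQ : spectralNormMat Q ≤ 1) :
    spectralNormMat (Q * X * Qᵀ) ≤ spectralNormMat X := by
  refine (spectralNormMat_mul_le _ _).trans ?_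
  rw [spectralNormMat_transpose]
  refine (mul_le_of_le_one_right (spectralNormMat_nonneg _) hQ).trans ?_
  exact (spectralNormMat_mul_le _ _).trans
    (mul_le_of_le_one_left (spectralNormMat_nonneg _) hQ)

lemma frobNorm_conj_sub_le {X Q : Matrix n n ℝ} {δ : ℝ} (hQ : spectralNormMat Q ≤ 1)
    (hQδ : spectralNormMat (Q - 1) ≤ δ) :
    frobNorm (Q * X * Qᵀ - X) ≤ 2 * δ * frobNorm X := by
  have heq : Q * X * Qᵀ - X = (Q - 1) * X * Qᵀ + X * (Q - 1)ᵀ := by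
    rw [transpose_sub, transpose_one]
    noncomm_ring
  have h1 : frobNorm ((Q - 1) * X * Qᵀ) ≤ δ * frobNorm X := by
    refine (frobNorm_mul_le_spectralNormMat_right _ _).trans ?_
    rw [spectralNormMat_transpose]
    refine (mul_le_of_le_one_right (frobNorm_nonneg _) hQ).trans ?_
    exact (frobNorm_mul_le_spectralNormMat_left _ _).trans
      (mul_le_mul_of_nonneg_right hQδ (frobNorm_nonneg _))
  have h2 : frobNorm (X * (Q - 1)ᵀ) ≤ δ * frobNorm X := by
    refine (frobNorm_mul_le_spectralNormMat_right _ _).trans ?_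
    rw [spectralNormMat_transpose, mul_comm]
    exact mul_le_mul_of_nonneg_right hQδ (frobNorm_nonneg _)
  rw [heq]
  linarith [frobNorm_add_le ((Q - 1) * X * Qᵀ) (X * (Q - 1)ᵀ)]

/-- Change of `-log det (1 - X)` under a contraction `Q` close to the identity. -/
lemma neg_log_det_one_sub_conj_le {X Q : Matrix n n ℝ} {δ : ℝ} (hX : X.IsSymm)
    (hX1 : spectralNormMat X < 1) (hQ : spectralNormMat Q ≤ 1) (hQδ : spectralNormMat (Q - 1) ≤ δ) :
    -Real.log (1 - Q * X * Qᵀ).det ≤ -Real.log (1 - X).det + (Q * X * Qᵀ - X).trace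
      + δ * (2 + δ) / (1 - spectralNormMat X) * frobNorm X ^ 2 := by
  set Y := Q * X * Qᵀ with hYdef
  have hY : Y.IsSymm := by
    rw [IsSymm, hYdef, transpose_mul, transpose_mul, transpose_transpose, hX.eq, mul_assoc]
  have hYX : spectralNormMat Y ≤ spectralNormMat X := spectralNormMat_conj_le hQ
  have hPY := posDef_one_sub_of_spectralNormMat_lt_one hY (hYX.trans_lt hX1)
  have hu := (isUnit_iff_isUnit_det _).1 hPY.isUnit
  -- The tangent is taken at 1 − Y, since concavity then bounds −log det(1 − Y) from above.
  have htan := (posDef_one_sub_of_spectralNormMat_lt_one hX hX1).log_det_le_add_trace hPY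
  set W := (1 - Y)⁻¹ * Y
  have hinv : (1 - Y)⁻¹ = 1 + W := by
    have := nonsing_inv_mul _ hu
    rw [mul_sub, mul_one] at this
    exact sub_eq_iff_eq_add.1 this
  have hW : W = Y + Y * W := by
    have : (1 - Y) * W = Y := mul_nonsing_inv_cancel_left _ _ hu
    rw [sub_mul, one_mul] at this
    exact sub_eq_iff_eq_add.1 this
  have htr : ((1 - Y)⁻¹ * (1 - X)).trace = Fintype.card n + (Y - X).trace
      + (W * (Y - X)).trace := by
    have : (1 - X) = (1 - Y) + (Y - X) := by abel
    rw [this, mul_add, nonsing_inv_mul _ hu, trace_add, trace_one, hinv, add_mul, one_mul,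
      trace_add]
    ring
  have hpos : 0 < 1 - spectralNormMat X := sub_pos.2 hX1
  have hWnorm : frobNorm W ≤ frobNorm X / (1 - spectralNormMat X) := by
    rw [le_div_iff₀ hpos]
    -- From W = Y + YW the norm of W occurs on both sides; ‖Y‖ ≤ ‖X‖ < 1 lets it be absorbed.
    have h1 : frobNorm W ≤ frobNorm Y + spectralNormMat Y * frobNorm W := by
      conv_lhs => rw [hW]
      exact (frobNorm_add_le _ _).trans
        (add_le_add_right (frobNorm_mul_le_spectralNormMat_left _ _) _)
    have h2 := mul_le_mul_of_nonneg_right hYX (frobNorm_nonneg W)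
    have h3 : frobNorm Y ≤ frobNorm X := frobNorm_conj_le hQ
    linarith
  have hδ : 0 ≤ δ := (spectralNormMat_nonneg _).trans hQδ
  have hlast : (W * (Y - X)).trace
      ≤ δ * (2 + δ) / (1 - spectralNormMat X) * frobNorm X ^ 2 := by
    refine (trace_mul_le_frobNorm _ _).trans ?_
    refine (mul_le_mul hWnorm (frobNorm_conj_sub_le hQ hQδ) (frobNorm_nonneg _)
      (div_nonneg (frobNorm_nonneg _) hpos.le)).trans ?_
    have : frobNorm X / (1 - spectralNormMat X) * (2 * δ * frobNorm X)
        = (2 * δ) / (1 - spectralNormMat X) * frobNorm X ^ 2 := by ring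
    rw [this]
    -- The argument gives the constant 2δ, relaxed here to δ(2 + δ).
    refine mul_le_mul_of_nonneg_right (div_le_div_of_nonneg_right ?_ hpos.le) (sq_nonneg _)
    nlinarith
  linarith

end LogDet

/-! ### The bound on the log-moment. -/

section LogMGF

variable {d : ℕ} {Θ Θs : Matrix (Fin d) (Fin d) ℝ} {γ δ : ℝ}

lemma sqrt_mulVec_dotProduct (Θ : Matrix (Fin d) (Fin d) ℝ) (x y : Fin d → ℝ) :
    (CFC.sqrt Θ *ᵥ x) ⬝ᵥ y = x ⬝ᵥ CFC.sqrt Θ *ᵥ y := by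
  rw [dotProduct_mulVec, ← mulVec_transpose, (isSymm_sqrt Θ).eq]

/-- Θ ⪯ Θs says |Θ^{1/2}y| ≤ |Θs^{1/2}y| for every y; take y = Θs^{-1/2}x. -/
lemma spectralNormMat_sqrt_mul_inv_sqrt_le_one (hΘs : Θs.PosDef) (hΘ : Θ.PosSemidef)
    (hle : Θ ≤ Θs) : spectralNormMat (CFC.sqrt Θ * (CFC.sqrt Θs)⁻¹) ≤ 1 := by
  refine spectralNormMat_le_one fun x => ?_
  set y := (CFC.sqrt Θs)⁻¹ *ᵥ x with hy
  have hx : x = CFC.sqrt Θs *ᵥ y := (hΘs.sqrt.mulVec_inv_mulVec x).symm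
  have hsq (A : Matrix (Fin d) (Fin d) ℝ) (hA : A.PosSemidef) :
      (CFC.sqrt A *ᵥ y) ⬝ᵥ (CFC.sqrt A *ᵥ y) = y ⬝ᵥ A *ᵥ y := by
    have := dotProduct_sqrt_mul_mul_sqrt_mulVec A 1 y
    rw [mul_one, CFC.sqrt_mul_sqrt_self A hA.nonneg, one_mulVec] at this
    exact this.symm
  rw [← mulVec_mulVec, ← hy, hsq Θ hΘ, hx, hsq Θs hΘs.posSemidef]
  have := (le_iff.1 hle).dotProduct_mulVec_self_nonneg y
  rw [sub_mulVec, dotProduct_sub] at this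
  linarith

lemma sqrt_mul_inv_sqrt_conj (hΘs : Θs.PosDef) (Θ H : Matrix (Fin d) (Fin d) ℝ) :
    CFC.sqrt Θ * (CFC.sqrt Θs)⁻¹ * (CFC.sqrt Θs * H * CFC.sqrt Θs) *
      (CFC.sqrt Θ * (CFC.sqrt Θs)⁻¹)ᵀ = CFC.sqrt Θ * H * CFC.sqrt Θ := by
  have hu := (isUnit_iff_isUnit_det _).1 hΘs.sqrt.isUnit
  rw [transpose_mul, transpose_nonsing_inv, (isSymm_sqrt Θ).eq, (isSymm_sqrt Θs).eq]
  simp only [mul_assoc]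
  rw [mul_nonsing_inv_cancel_left _ _ hu, nonsing_inv_mul_cancel_left _ _ hu]

lemma trace_sqrt_mul_mul_sqrt (hΘ : Θ.PosSemidef) (H : Matrix (Fin d) (Fin d) ℝ) :
    (CFC.sqrt Θ * H * CFC.sqrt Θ).trace = (Θ * H).trace := by
  rw [trace_mul_comm, ← mul_assoc, CFC.sqrt_mul_sqrt_self Θ hΘ.nonneg]

lemma neg_half_log_det_le_Upsilon (hΘs : Θs.PosDef) (hΘ : Θ.PosSemidef) (hle : Θ ≤ Θs)
    (hΘδ : spectralNormMat (CFC.sqrt Θ * (CFC.sqrt Θs)⁻¹ - 1) ≤ δ) (hγ0 : 0 ≤ γ) (hγ : γ < 1)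
    {H : SymMat (Fin d)} (hH : H ∈ HGamma γ Θs) :
    -(1 / 2) * Real.log (1 - CFC.sqrt Θ * H.1 * CFC.sqrt Θ).det ≤ Upsilon Θs δ H.1 Θ := by
  have h := neg_log_det_one_sub_conj_le (isSymm_sqrt_mul_mul_sqrt Θs H)
    (((mem_HGamma_iff_spectralNormMat_le hΘs hγ0).1 hH).trans_lt hγ)
    (spectralNormMat_sqrt_mul_inv_sqrt_le_one hΘs hΘ hle) hΘδ
  rw [sqrt_mul_inv_sqrt_conj hΘs, trace_sub, trace_sqrt_mul_mul_sqrt hΘ,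
    trace_sqrt_mul_mul_sqrt hΘs.posSemidef] at h
  have hdiv (s f : ℝ) : δ * (2 + δ) / (2 * (1 - s)) * f = 1 / 2 * (δ * (2 + δ) / (1 - s) * f) := by
    rw [mul_comm 2, div_mul_eq_div_div]
    ring
  rw [Upsilon, hdiv, sub_mul, trace_sub]
  linarith

lemma posDef_one_sub_sqrt_mul_mul_sqrt (hΘs : Θs.PosDef) (hΘ : Θ.PosSemidef) (hle : Θ ≤ Θs)
    (hγ0 : 0 ≤ γ) (hγ : γ < 1) {H : SymMat (Fin d)} (hH : H ∈ HGamma γ Θs) :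
    (1 - CFC.sqrt Θ * H.1 * CFC.sqrt Θ).PosDef := by
  refine posDef_one_sub_of_spectralNormMat_lt_one (isSymm_sqrt_mul_mul_sqrt Θ H) ?_
  rw [← sqrt_mul_inv_sqrt_conj hΘs]
  exact (spectralNormMat_conj_le
    (spectralNormMat_sqrt_mul_inv_sqrt_le_one hΘs hΘ hle)).trans_lt
    (((mem_HGamma_iff_spectralNormMat_le hΘs hγ0).1 hH).trans_lt hγ)

/-- The left side is |Qᵀw|² with Q = Θ^{1/2}Θs^{-1/2}, and the transpose of a contraction is a
contraction. -/
lemma sqrt_mulVec_dotProduct_inv_le (hΘs : Θs.PosDef) (hΘ : Θ.PosSemidef) (hle : Θ ≤ Θs)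
    (w : Fin d → ℝ) : (CFC.sqrt Θ *ᵥ w) ⬝ᵥ Θs⁻¹ *ᵥ (CFC.sqrt Θ *ᵥ w) ≤ w ⬝ᵥ w := by
  have h := mulVec_dotProduct_mulVec_le (CFC.sqrt Θ * (CFC.sqrt Θs)⁻¹)ᵀ w
  rw [spectralNormMat_transpose] at h
  refine le_trans (le_of_eq ?_) (h.trans (mul_le_of_le_one_left
    (by simpa using dotProduct_star_self_nonneg w) (pow_le_one₀ (spectralNormMat_nonneg _)
    (spectralNormMat_sqrt_mul_inv_sqrt_le_one hΘs hΘ hle))))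
  rw [transpose_mul, transpose_nonsing_inv, (isSymm_sqrt Θ).eq, (isSymm_sqrt Θs).eq,
    ← mulVec_mulVec]
  set x := CFC.sqrt Θ *ᵥ w
  obtain ⟨y, hy⟩ : ∃ y, x = CFC.sqrt Θs *ᵥ y := ⟨_, (hΘs.sqrt.mulVec_inv_mulVec x).symm⟩
  rw [hy, sqrt_mulVec_dotProduct_inv hΘs, mulVec_mulVec,
    nonsing_inv_mul _ ((isUnit_iff_isUnit_det _).1 hΘs.sqrt.isUnit), one_mulVec]

lemma integral_exp_quadratic_multivariateGaussian (θ h : EuclideanSpace ℝ (Fin d))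
    (H : SymMat (Fin d)) (hpos : (1 - CFC.sqrt Θ * H.1 * CFC.sqrt Θ).PosDef) :
    ∫ ζ : EuclideanSpace ℝ (Fin d),
        Real.exp ((h.ofLp ⬝ᵥ ζ.ofLp) + (1 / 2) * (ζ.ofLp ⬝ᵥ (H.1 *ᵥ ζ.ofLp)))
        ∂(multivariateGaussian θ Θ)
      = Real.exp (h.ofLp ⬝ᵥ θ.ofLp + 1 / 2 * (θ.ofLp ⬝ᵥ H.1 *ᵥ θ.ofLp)) *
        ((√(1 - CFC.sqrt Θ * H.1 * CFC.sqrt Θ).det)⁻¹ *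
          Real.exp (1 / 2 * ((CFC.sqrt Θ *ᵥ (H.1 *ᵥ θ.ofLp + h.ofLp)) ⬝ᵥ
            (1 - CFC.sqrt Θ * H.1 * CFC.sqrt Θ)⁻¹ *ᵥ
              (CFC.sqrt Θ *ᵥ (H.1 *ᵥ θ.ofLp + h.ofLp))))) := by
  rw [← integral_exp_quadratic_stdGaussian (isSymm_sqrt_mul_mul_sqrt Θ H) hpos,
    ← integral_const_mul, multivariateGaussian, integral_map (by fun_prop)
      (Measurable.aestronglyMeasurable (by simp only [dotProduct, mulVec]; fun_prop))]
  refine integral_congr_ae (Filter.Eventually.of_forall fun x => ?_)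
  simp only
  rw [← Real.exp_add]
  congr 1
  have h1 : (θ + toEuclideanCLM (𝕜 := ℝ) (CFC.sqrt Θ) x).ofLp = θ.ofLp + CFC.sqrt Θ *ᵥ x.ofLp := rfl
  rw [h1, sqrt_mulVec_dotProduct, dotProduct_sqrt_mul_mul_sqrt_mulVec, mulVec_add, dotProduct_add, dotProduct_add,
    add_dotProduct, add_dotProduct, add_dotProduct, (SymMat.isSymm H).dotProduct_mulVec_comm θ.ofLp (CFC.sqrt Θ *ᵥ x.ofLp),
    dotProduct_comm (H.1 *ᵥ θ.ofLp)]
  ring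

/-- Lower bounds for `Γ` obtained from the Fenchel inequality. -/
lemma le_GammaFun (hΘs : Θs.PosDef) (hγ : γ < 1) {H : SymMat (Fin d)} (hH : H ∈ HGamma γ Θs)
    (h : EuclideanSpace ℝ (Fin d)) {Z : SymMat (Fin d ⊕ Unit)} (hZ : Z ∈ ZPlus d) (y : Fin d → ℝ) :
    1 / 2 * ((Z.1.toBlocks₁₁ * H.1).trace + 2 * (h.ofLp ⬝ᵥ fun i => Z.1 (Sum.inl i) (Sum.inr ()))
      + (2 * ((H.1 *ᵥ (fun i => Z.1 (Sum.inl i) (Sum.inr ())) + h.ofLp) ⬝ᵥ y)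
        - y ⬝ᵥ (Θs⁻¹ - H.1) *ᵥ y)) ≤ GammaFun Θs h H.1 Z.1 := by
  have hP := posDef_inv_sub_of_mem_HGamma hΘs hγ hH
  have hZs := SymMat.isSymm Z
  have hbord : (Z.1 * borderedMat h H.1).trace = (Z.1.toBlocks₁₁ * H.1).trace
      + 2 * (h.ofLp ⬝ᵥ fun i => Z.1 (Sum.inl i) (Sum.inr ())) := by
    have hsw (i : Fin d) : Z.1 (Sum.inr ()) (Sum.inl i) = Z.1 (Sum.inl i) (Sum.inr ()) :=
      hZs.apply _ _
    simp only [trace, diag_apply, mul_apply, Fintype.sum_sum_type, borderedMat, fromBlocks_apply₁₁,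
      fromBlocks_apply₁₂, fromBlocks_apply₂₁, fromBlocks_apply₂₂, replicateCol_apply,
      replicateRow_apply, toBlocks₁₁, of_apply, dotProduct, Finset.univ_unique,
      Finset.sum_singleton, Finset.sum_add_distrib, PUnit.default_eq_unit, hsw, Matrix.zero_apply,
      mul_zero, add_zero, two_mul, mul_comm (h.ofLp _), add_assoc]
  obtain ⟨B, hB⟩ := hZ.1.exists_transpose_mul_self
  have hone : ∑ k, B k (Sum.inr ()) ^ 2 = 1 := by
    rw [← hZ.2, hB, mul_apply]
    exact Finset.sum_congr rfl fun k _ => by rw [transpose_apply, sq]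
  have hcol : ∑ k, B k (Sum.inr ()) • (appendCol h H.1 *ᵥ B k)
      = H.1 *ᵥ (fun i => Z.1 (Sum.inl i) (Sum.inr ())) + h.ofLp := by
    have h1 : ∑ k, B k (Sum.inr ()) • (appendCol h H.1 *ᵥ B k)
        = appendCol h H.1 *ᵥ (fun i => Z.1 i (Sum.inr ())) := by
      simp_rw [← mulVec_smul]
      rw [← mulVec_sum]
      congr 1
      ext i
      simp [hB, mul_apply, mul_comm]
    rw [h1]
    ext i
    simp [appendCol, mulVec, dotProduct, hZ.2]
  -- Row k is tested at y scaled by its last entry. The squares of these weights sum to the corner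
  -- entry of Z, which is 1, so a single quadratic term in y survives.
  have hsum := Finset.sum_le_sum fun (k : Fin d ⊕ Unit) (_ : k ∈ Finset.univ) =>
    hP.two_mul_dotProduct_sub_le (appendCol h H.1 *ᵥ B k) (B k (Sum.inr ()) • y)
  have hleft : ∑ k, (2 * ((appendCol h H.1 *ᵥ B k) ⬝ᵥ (B k (Sum.inr ()) • y))
      - (B k (Sum.inr ()) • y) ⬝ᵥ (Θs⁻¹ - H.1) *ᵥ (B k (Sum.inr ()) • y))
      = 2 * ((H.1 *ᵥ (fun i => Z.1 (Sum.inl i) (Sum.inr ())) + h.ofLp) ⬝ᵥ y)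
        - y ⬝ᵥ (Θs⁻¹ - H.1) *ᵥ y := by
    rw [← hcol, sum_dotProduct, Finset.sum_sub_distrib, ← Finset.mul_sum]
    congr 1
    · simp [smul_dotProduct, dotProduct_smul]
    · simp only [mulVec_smul, smul_dotProduct, dotProduct_smul, smul_eq_mul, ← mul_assoc, ← sq]
      rw [← Finset.sum_mul, hone, one_mul]
  rw [hleft] at hsum
  rw [hB, GammaFun_transpose_mul_self, ← hB, hbord]
  linarith

lemma quadLift_mem_ZPlus (θ : EuclideanSpace ℝ (Fin d)) : quadLift θ ∈ ZPlus d := by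
  refine ⟨?_, by simp [quadLift, vecMulVec_apply]⟩
  have := posSemidef_vecMulVec_self_star
    (Sum.elim (fun i => θ i) (fun _ => 1) : Fin d ⊕ Unit → ℝ)
  rwa [star_trivial] at this

lemma integrable_and_log_integral_le_PhiFun (hΘs : Θs.PosDef) (hγ0 : 0 ≤ γ) (hγ : γ < 1)
    {Θ : SymMat (Fin d)} (hΘ : Θ.1.PosSemidef) (hle : Θ.1 ≤ Θs)
    (hΘδ : spectralNormMat (CFC.sqrt Θ.1 * (CFC.sqrt Θs)⁻¹ - 1) ≤ δ)
    (θ h : EuclideanSpace ℝ (Fin d)) {H : SymMat (Fin d)} (hH : H ∈ HGamma γ Θs) :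
    Integrable (fun ζ : EuclideanSpace ℝ (Fin d) =>
        Real.exp ((h.ofLp ⬝ᵥ ζ.ofLp) + (1 / 2) * (ζ.ofLp ⬝ᵥ (H.1 *ᵥ ζ.ofLp))))
        (multivariateGaussian θ Θ.1) ∧
      Real.log (∫ ζ : EuclideanSpace ℝ (Fin d),
        Real.exp ((h.ofLp ⬝ᵥ ζ.ofLp) + (1 / 2) * (ζ.ofLp ⬝ᵥ (H.1 *ᵥ ζ.ofLp)))
        ∂(multivariateGaussian θ Θ.1)) ≤ PhiFun Θs δ (h, H) (Θ, quadLift θ) := by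
  have hpos := posDef_one_sub_sqrt_mul_mul_sqrt hΘs hΘ hle hγ0 hγ hH
  have hint := integral_exp_quadratic_multivariateGaussian θ h H hpos
  have hsqrt : 0 < √(1 - CFC.sqrt Θ.1 * H.1 * CFC.sqrt Θ.1).det := Real.sqrt_pos.2 hpos.det_pos
  -- A non-integrable function has integral 0 by convention, so a positive value proves
  -- integrability.
  refine ⟨Integrable.of_integral_ne_zero (hint ▸ by positivity), ?_⟩
  rw [hint, Real.log_mul (by positivity) (by positivity), Real.log_mul (by positivity)
    (by positivity), Real.log_exp, Real.log_exp, Real.log_inv, Real.log_sqrt hpos.det_pos.le]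
  have hU := neg_half_log_det_le_Upsilon hΘs hΘ hle hΘδ hγ0 hγ hH
  set v := H.1 *ᵥ θ.ofLp + h.ofLp with hv
  set w := (1 - CFC.sqrt Θ.1 * H.1 * CFC.sqrt Θ.1)⁻¹ *ᵥ (CFC.sqrt Θ.1 *ᵥ v) with hw
  -- w is the Fenchel maximiser for 1 − Y. At y = Θ^{1/2}w the H-terms of the two objectives agree,
  -- and yᵀΘs⁻¹y ≤ |w|² makes the bound on Γ dominate.
  have hG := le_GammaFun hΘs hγ hH h (quadLift_mem_ZPlus θ) (CFC.sqrt Θ.1 *ᵥ w)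
  have hz : (fun i => (quadLift θ).1 (Sum.inl i) (Sum.inr ())) = θ.ofLp := by
    ext i
    simp [quadLift, vecMulVec_apply]
  have htr : ((quadLift θ).1.toBlocks₁₁ * H.1).trace = θ.ofLp ⬝ᵥ H.1 *ᵥ θ.ofLp := by
    simp only [quadLift, trace, diag_apply, mul_apply, toBlocks₁₁, of_apply, vecMulVec_apply,
      Sum.elim_inl, dotProduct, mulVec, Finset.mul_sum]
    refine Finset.sum_congr rfl fun i _ => Finset.sum_congr rfl fun j _ => ?_
    rw [(SymMat.isSymm H).apply]
    ring
  rw [hz, htr, ← hv] at hG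
  have hfen := hpos.two_mul_dotProduct_sub_eq (CFC.sqrt Θ.1 *ᵥ v)
  have hvw := sqrt_mulVec_dotProduct Θ.1 v w
  rw [← hw, hvw, sub_mulVec, one_mulVec, dotProduct_sub, dotProduct_sqrt_mul_mul_sqrt_mulVec] at hfen
  have hbound := sqrt_mulVec_dotProduct_inv_le hΘs hΘ hle w
  rw [sub_mulVec, dotProduct_sub] at hG
  rw [hvw]
  simp only [PhiFun]
  linarith

end LogMGF

/-! ### Coercivity. -/

section Coercive

variable {d : ℕ} {Θs : Matrix (Fin d) (Fin d) ℝ} {γ δ : ℝ}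

lemma pairNorm_le (p : EuclideanSpace ℝ (Fin d) × SymMat (Fin d)) :
    pairNorm p ≤ ‖p.1‖ + frobNorm p.2.1 := by
  refine Real.sqrt_le_iff.2 ⟨add_nonneg (norm_nonneg _) (frobNorm_nonneg _), ?_⟩
  nlinarith [mul_nonneg (norm_nonneg p.1) (frobNorm_nonneg p.2.1)]

lemma exists_quadratic_le_PhiFun (hΘs : Θs.PosDef) (hγ0 : 0 ≤ γ) (hγ : γ < 1)
    (Θ : SymMat (Fin d)) {Z : SymMat (Fin d ⊕ Unit)} (hZ : Z ∈ ZPlus d) :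
    ∃ a b c : ℝ, 0 < a ∧ ∀ (h : EuclideanSpace ℝ (Fin d)), ∀ H ∈ HGamma γ Θs,
      a * ‖h‖ ^ 2 - b * ‖h‖ - c ≤ PhiFun Θs δ (h, H) (Θ, Z) := by
  have hval : Continuous (Subtype.val : SymMat (Fin d) → _) := continuous_subtype_val
  set z : Fin d → ℝ := fun i => Z.1 (Sum.inl i) (Sum.inr ()) with hz
  have hcont : ContinuousOn (fun H : SymMat (Fin d) =>
      Upsilon Θs δ H Θ + 1 / 2 * (Z.1.toBlocks₁₁ * H.1).trace) (HGamma γ Θs) := by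
    refine ((continuousOn_Upsilon hΘs hγ0 hγ).comp
      (continuous_id.prodMk continuous_const).continuousOn fun H hH => ⟨hH, trivial⟩).add
      (continuousOn_const.mul (Continuous.continuousOn (Continuous.matrix_trace (by fun_prop))))
  obtain ⟨c, hc⟩ := (isCompact_HGamma hΘs hγ0).exists_bound_of_continuousOn hcont
  obtain ⟨C, hC⟩ := (isCompact_HGamma hΘs hγ0).exists_bound_of_continuousOn
    (f := fun H : SymMat (Fin d) => WithLp.toLp 2 (H.1 *ᵥ z)) (Continuous.continuousOn
      ((PiLp.continuous_toLp 2 _).comp (hval.matrix_mulVec continuous_const)))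
  set K := spectralNormMat Θs⁻¹ + 1 with hK
  have hK0 : 0 < K := by linarith [spectralNormMat_nonneg Θs⁻¹]
  set t := (2 * K)⁻¹ with ht
  have ht0 : 0 < t := by positivity
  -- Testing at y = th gives t‖h‖² minus at most ½t²·2K‖h‖² = (t/2)‖h‖², since t = 1/(2K). The terms
  -- in z and Hz are linear in ‖h‖; compactness of H_γ bounds Hz by C and the part free of h by c.
  refine ⟨t / 2, ‖WithLp.toLp 2 z‖ + t * C, c, by positivity, fun h H hH => ?_⟩
  have hG := le_GammaFun hΘs hγ hH h hZ (t • h.ofLp)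
  have h1 := hc H hH
  have h2 := hC H hH
  rw [Real.norm_eq_abs, abs_le] at h1
  rw [← hz] at hG
  have hhh : h.ofLp ⬝ᵥ h.ofLp = ‖h‖ ^ 2 := dotProduct_self_eq_norm_sq h.ofLp
  have hin (x : Fin d → ℝ) : -(‖WithLp.toLp 2 x‖ * ‖h‖) ≤ x ⬝ᵥ h.ofLp := by
    have := (abs_le.1 (abs_real_inner_le_norm (WithLp.toLp 2 x) h)).1
    refine this.trans_eq ?_
    simp [PiLp.inner_apply, dotProduct, mul_comm]
  have h3 := hin z
  have h4 := hin (H.1 *ᵥ z)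
  have h5 : h.ofLp ⬝ᵥ (Θs⁻¹ - H.1) *ᵥ h.ofLp ≤ 2 * K * ‖h‖ ^ 2 := by
    have h6 := (abs_le.1 ((mem_HGamma_iff_abs_le hΘs).1 hH h.ofLp)).1
    have h7 := (abs_le.1 (abs_dotProduct_mulVec_le Θs⁻¹ h.ofLp)).2
    have h8 := hΘs.inv.posSemidef.dotProduct_mulVec_self_nonneg h.ofLp
    rw [hhh] at h7
    rw [sub_mulVec, dotProduct_sub]
    nlinarith [sq_nonneg ‖h‖]
  have h9 : t * t * (h.ofLp ⬝ᵥ (Θs⁻¹ - H.1) *ᵥ h.ofLp) ≤ t * ‖h‖ ^ 2 := by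
    refine (mul_le_mul_of_nonneg_left h5 (by positivity)).trans_eq ?_
    rw [ht]
    field_simp
  have h10 : t * (‖WithLp.toLp 2 (H.1 *ᵥ z)‖ * ‖h‖) ≤ t * (C * ‖h‖) :=
    mul_le_mul_of_nonneg_left (mul_le_mul_of_nonneg_right h2 (norm_nonneg _)) ht0.le
  have h11 := mul_le_mul_of_nonneg_left h4 ht0.le
  simp only [add_dotProduct, dotProduct_smul, mulVec_smul, smul_dotProduct, smul_eq_mul, hhh,
    dotProduct_comm h.ofLp z] at hG
  simp only [PhiFun]
  linarith [h1.1]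

lemma tendsto_PhiFun_atTop (hΘs : Θs.PosDef) (hγ0 : 0 ≤ γ) (hγ : γ < 1)
    (Θ : SymMat (Fin d)) {Z : SymMat (Fin d ⊕ Unit)} (hZ : Z ∈ ZPlus d)
    {ι : Type*} {l : Filter ι} {p : ι → EuclideanSpace ℝ (Fin d) × SymMat (Fin d)}
    (hp : ∀ i, (p i).2 ∈ HGamma γ Θs) (hlim : Filter.Tendsto (fun i => pairNorm (p i)) l .atTop) :
    Filter.Tendsto (fun i => PhiFun Θs δ (p i) (Θ, Z)) l .atTop := by
  obtain ⟨a, b, c, ha, hbound⟩ := exists_quadratic_le_PhiFun (δ := δ) hΘs hγ0 hγ Θ hZ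
  obtain ⟨C, hC⟩ := (isCompact_HGamma hΘs hγ0).exists_bound_of_continuousOn
    (f := fun H : SymMat (Fin d) => frobNorm H.1)
    (continuous_subtype_val.frobNorm).continuousOn
  -- `frobNorm` is bounded on the compact set H_γ, so the h-component must diverge.
  have hnorm : Filter.Tendsto (fun i => ‖(p i).1‖) l .atTop := by
    refine Filter.tendsto_atTop_mono (fun i => ?_) (Filter.tendsto_atTop_add_const_right l (-C) hlim)
    have := (le_abs_self _).trans (hC _ (hp i))
    linarith [pairNorm_le (p i)]
  have hquad : Filter.Tendsto (fun s : ℝ => s * (a * s - b) - c) .atTop .atTop := by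
    refine Filter.tendsto_atTop_add_const_right _ (-c) (Filter.tendsto_id.atTop_mul_atTop₀ ?_)
    exact Filter.tendsto_atTop_add_const_right _ (-b) (Filter.tendsto_id.const_mul_atTop ha)
  refine Filter.tendsto_atTop_mono (fun i => ?_) (hquad.comp hnorm)
  refine le_trans (le_of_eq ?_) (hbound (p i).1 (p i).2 (hp i))
  simp only [Function.comp_apply]
  ring

end Coercive

theorem proposition2p1 (d : ℕ) (V : Set (SymMat (Fin d)))
    (hVne : V.Nonempty) (hVconv : Convex ℝ V) (hVcomp : IsCompact V)
    (hVpsd : ∀ Θ ∈ V, (Θ : Matrix (Fin d) (Fin d) ℝ).PosSemidef)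
    (Θs : Matrix (Fin d) (Fin d) ℝ) (hΘs : Θs.PosDef) (δ : ℝ) (hδ : 0 ≤ δ)
    (hdom : ∀ Θ ∈ V, (Θ : Matrix (Fin d) (Fin d) ℝ) ≤ Θs ∧
      spectralNormMat (CFC.sqrt (Θ : Matrix (Fin d) (Fin d) ℝ) * (CFC.sqrt Θs)⁻¹ - 1) ≤ δ)
    (γ : ℝ) (hγ0 : 0 < γ) (hγ1 : γ < 1) :
    (IsRegularData ((Set.univ : Set (EuclideanSpace ℝ (Fin d))) ×ˢ HGamma γ Θs)
        (V ×ˢ ZPlus d) (PhiFun Θs δ) ∧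
      ∀ (θ : EuclideanSpace ℝ (Fin d)), ∀ Θ ∈ V,
        ∀ (h : EuclideanSpace ℝ (Fin d)), ∀ H ∈ HGamma γ Θs,
          Integrable (fun ζ : EuclideanSpace ℝ (Fin d) =>
              Real.exp ((h.ofLp ⬝ᵥ ζ.ofLp)
                + (1 / 2) * (ζ.ofLp ⬝ᵥ ((H : Matrix (Fin d) (Fin d) ℝ) *ᵥ ζ.ofLp))))
            (multivariateGaussian θ (Θ : Matrix (Fin d) (Fin d) ℝ)) ∧
          Real.log (∫ ζ : EuclideanSpace ℝ (Fin d),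
              Real.exp ((h.ofLp ⬝ᵥ ζ.ofLp)
                + (1 / 2) * (ζ.ofLp ⬝ᵥ ((H : Matrix (Fin d) (Fin d) ℝ) *ᵥ ζ.ofLp)))
              ∂(multivariateGaussian θ (Θ : Matrix (Fin d) (Fin d) ℝ)))
            ≤ PhiFun Θs δ (h, H) (Θ, quadLift θ)) ∧
    (∀ Θ ∈ V, ∀ Z ∈ ZPlus d,
      ∀ p : ℕ → EuclideanSpace ℝ (Fin d) × SymMat (Fin d),
        (∀ i, (p i).2 ∈ HGamma γ Θs) →
        Filter.Tendsto (fun i => pairNorm (p i)) Filter.atTop Filter.atTop →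
        Filter.Tendsto (fun i => PhiFun Θs δ (p i) (Θ, Z)) Filter.atTop Filter.atTop) := by

  refine ⟨⟨isRegularData_PhiFun hVconv hVcomp.isClosed hΘs hγ0 hγ1 hδ, ?_⟩, ?_⟩
  · intro θ Θ hΘ h H hH
    exact integrable_and_log_integral_le_PhiFun hΘs hγ0.le hγ1 (hVpsd Θ hΘ) (hdom Θ hΘ).1
      (hdom Θ hΘ).2 θ h hH
  · intro Θ _ Z hZ p hp hlim
    exact tendsto_PhiFun_atTop hΘs hγ0.le hγ1 Θ hZ hp hlim
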